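/- Let $k$ be an algebraically closed field of characteristic zero. A \emph{rational ruled surface} is an irreducible algebraic surface $S\subset k^3$ such that through every point of $S$ there passes a line contained in $S$, and such that $S$ admits a rational parametrization, i.e. a dominant rational map $k^2\dashrightarrow S$. A parametrization of $S$ is \emph{in ruled form} if it is a dominant rational map $k^2\dashrightarrow S$ of the form \[ \mathcal P(s,t)=\left(\frac{r_1(s)+t\,p_1(s)}{q(s)},\frac{r_2(s)+t\,p_2(s)}{q(s)},\frac{r_3(s)+t\,p_3(s)}{q(s)}\right),\qquad r_i,p_i,q\in k[s],\ q\neq 0; \] it is a \emph{standardized ruled surface parametrization} if, moreover, those $p_i$ that are nonzero have the same degree and have no common root (and not all $p_i$ are zero). Every rational ruled surface $S$ admits a standardized ruled surface parametrization. Moreover, for every parametrization $\mathcal P$ of $S$ in ruled form there is a standardized ruled surface parametrization $\mathcal Q$ of $S$ that is obtained from $\mathcal P$ by successive changes of parameters of the forms $(s,t)\mapsto(s,\lambda s+\mu t)$, $(s,t)\mapsto\left(\frac{as+b}{cs+d},t\right)$ and $(s,t)\mapsto(s,t/\Delta(s))$, that is, \[ \mathcal Q(s,t)=\mathcal P\left(\sigma(s),\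 \lambda\,\sigma(s)+\mu\,\frac{t}{\Delta(s)}\right),\qquad \sigma(s)=\frac{as+b}{cs+d}, \] with $\lambda,\mu,a,b,c,d\in k$, $\mu\neq0$, $ad-bc\neq0$ and $0\neq\Delta\in k[s]$. -/

import Mathlib

namespace RuledSurface

open Polynomial

/-- A triple of rational functions in two variables, written over a common denominator;
it determines a rational map from the plane `k²` to the space `k³`. -/
structure PlaneMap (k : Type*) [Field k] where
  num : Fin 3 → MvPolynomial (Fin 2) k
  den : MvPolynomial (Fin 2) k
  den_ne_zero : den ≠ 0

namespace PlaneMap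

variable {k : Type*} [Field k]

/-- The value `P(a, b)`, for `a` and `b` in an arbitrary field extension of `k`. -/
noncomputable def evalAt (P : PlaneMap k) {L : Type*} [Field L] [Algebra k L] (a b : L) :
    Fin 3 → L :=
  fun i => MvPolynomial.aeval ![a, b] (P.num i) / MvPolynomial.aeval ![a, b] P.den

/-- The set of the points `P(a, b)` with `a, b ∈ k` at which the denominator does not vanish. -/
def image (P : PlaneMap k) : Set (Fin 3 → k) :=
  {x | ∃ a b : k, MvPolynomial.aeval ![a, b] P.den ≠ 0 ∧ x = P.evalAt a b}

/-- `P` is a parametrization of `S`, that is, a dominant rational map from `k²` to `S`: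
the Zariski closure of its image is `S`. -/
def Parametrizes (P : PlaneMap k) (S : Set (Fin 3 → k)) : Prop :=
  MvPolynomial.zeroLocus k (MvPolynomial.vanishingIdeal k P.image) = S

end PlaneMap

variable {k : Type*} [Field k]

/-- An irreducible algebraic surface in the affine space `k³`. -/
def IsSurface (S : Set (Fin 3 → k)) : Prop :=
  ∃ F : MvPolynomial (Fin 3) k, Irreducible F ∧ S = {x | MvPolynomial.eval x F = 0}

/-- Through every point of `S` there passes a line that is contained in `S`. -/
def IsRuled (S : Set (Fin 3 → k)) : Prop :=
  ∀ x ∈ S, ∃ v : Fin 3 → k, v ≠ 0 ∧ ∀ u : k, x + u • v ∈ S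

/-- `S` admits a rational parametrization. -/
def IsRational (S : Set (Fin 3 → k)) : Prop :=
  ∃ P : PlaneMap k, P.Parametrizes S

/-- A rational ruled surface in `k³`. -/
structure IsRationalRuledSurface (S : Set (Fin 3 → k)) : Prop where
  surface : IsSurface S
  ruled : IsRuled S
  rational : IsRational S

/-- The data of a triple of rational functions in ruled form,
`(s, t) ↦ ((rᵢ(s) + t pᵢ(s)) / q(s))` for `i = 1, 2, 3`. -/
structure RuledForm (k : Type*) [Field k] where
  r : Fin 3 → k[X]
  p : Fin 3 → k[X]
  q : k[X]
  q_ne_zero : q ≠ 0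

namespace RuledForm

/-- The rational map given by a triple in ruled form; the variables `0` and `1` are `s` and `t`. -/
noncomputable def toPlaneMap (P : RuledForm k) : PlaneMap k where
  num i := aeval (MvPolynomial.X 0) (P.r i) + MvPolynomial.X 1 * aeval (MvPolynomial.X 0) (P.p i)
  den := aeval (MvPolynomial.X 0) P.q
  den_ne_zero := by
    intro h
    exact P.q_ne_zero ((transcendental_iff.1 (MvPolynomial.transcendental_X k (0 : Fin 2))) _ h)

/-- `P` is a standardized ruled surface parametrization of `S`: it is a parametrization of `S`,
and those `pᵢ` that are nonzero have the same degree and no common root. (If all the `pᵢ` were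
zero, every element of `k` would be a common root, so the last condition excludes this.) -/
structure IsStandardized (P : RuledForm k) (S : Set (Fin 3 → k)) : Prop where
  parametrizes : P.toPlaneMap.Parametrizes S
  natDegree_eq : ∀ i j, P.p i ≠ 0 → P.p j ≠ 0 → (P.p i).natDegree = (P.p j).natDegree
  no_common_root : ¬ ∃ z : k, ∀ i, P.p i ≠ 0 → (P.p i).IsRoot z

end RuledForm

/-- The field `k(s, t)` of rational functions in two variables. -/
abbrev FunField (k : Type*) [Field k] : Type _ := FractionRing (MvPolynomial (Fin 2) k)

namespace FunField

variable (k)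

/-- The first parameter `s` as an element of `k(s, t)`. -/
noncomputable def s : FunField k := algebraMap (MvPolynomial (Fin 2) k) (FunField k) (.X 0)

/-- The second parameter `t` as an element of `k(s, t)`. -/
noncomputable def t : FunField k := algebraMap (MvPolynomial (Fin 2) k) (FunField k) (.X 1)

end FunField

/-- `Q` is obtained from `P` by successive changes of the parameters of the three forms
`(s, l s + m t)` with `m ≠ 0`, `((a s + b) / (c s + d), t)` with `a d - b c ≠ 0`, and
`(s, t / Δ(s))` with `Δ` a nonzero polynomial. -/
def IsReparametrization (Q P : PlaneMap k) : Prop :=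
  ∃ (l m a b c d : k) (Δ : k[X]), m ≠ 0 ∧ a * d - b * c ≠ 0 ∧ Δ ≠ 0 ∧
    ∃ σ τ : FunField k,
      σ = (a • FunField.s k + algebraMap k (FunField k) b) /
        (c • FunField.s k + algebraMap k (FunField k) d) ∧
      τ = l • σ + m • (FunField.t k / aeval (FunField.s k) Δ) ∧
      Q.evalAt (FunField.s k) (FunField.t k) = P.evalAt σ τ

end RuledSurface

/-! Standardizing a ruled form is elementary (`RuledForm.exists_isStandardized`). Substitute `s ↦ a
+ 1/s`, with `a` not a root of any nonzero `pᵢ`, and multiply through by `s ^ N`: the nonzero `pᵢ`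
all acquire degree `N`, with leading coefficients `pᵢ(a)`. Dividing them by their gcd `Δ`, which is
the change `t ↦ t/Δ`, removes the common roots and lowers all degrees equally. Some `pᵢ` is nonzero
because a curve is not dense in a surface.

The real work is the existence of a ruled form (`exists_ruledForm`). A line in the surface `F = 0`
has an asymptotic direction, i.e. a zero of the second fundamental form. If that form vanishes
identically, the surface is a plane (`exists_dvd_linear`). Otherwise the asymptotic directions at
the generic point correspond to the square roots `±e` of a discriminant, and a specialization
argument shows that one of them is the direction of a line in the surface
(`exists_direction_generic`).

If `e` lies in `k(s,t)`, this is a rational field of lines, and the lines through a suitable curve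
sweep out the surface (`exists_ruledForm_of_direction`). If not, conjugation shows that both
asymptotic directions at every point give lines; along one fixed line its own direction yields a
polynomial square root `E` of the discriminant, and `-E` yields the transversal lines, which sweep
out the surface (`exists_ruledForm_of_forall_direction`). Each time `RuledForm.parametrizes_of_ne`,
a dimension count, gives density. -/

namespace RuledSurface

open MvPolynomial

universe u

/-! ### Points over `k`: consequences of the Nullstellensatz. -/

section Nullstellensatz

variable {k : Type u} [Field k] [IsAlgClosed k]

theorem dvd_of_eval_eq_zero {σ : Type*} [Finite σ] {F G : MvPolynomial σ k} (hF : Irreducible F)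
    (h : ∀ x, eval x F = 0 → eval x G = 0) : F ∣ G := by
  have hp : (Ideal.span {F}).IsPrime :=
    (Ideal.span_singleton_prime hF.ne_zero).2 hF.prime
  rw [← Ideal.mem_span_singleton,
    ← MvPolynomial.IsPrime.vanishingIdeal_zeroLocus (K := k) (Ideal.span {F}),
    mem_vanishingIdeal_iff]
  intro x hx
  rw [zeroLocus_span] at hx
  simpa using h x (by simpa using hx)

/-- A nonzero element of a finitely generated domain is nonzero at some `k`-point. -/
theorem exists_algHom_ne_zero {A : Type*} [CommRing A] [IsDomain A] [Algebra k A]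
    [Algebra.FiniteType k A] {c : A} (hc : c ≠ 0) : ∃ φ : A →ₐ[k] k, φ c ≠ 0 := by
  obtain ⟨n, f, hf⟩ := Algebra.FiniteType.iff_quotient_mvPolynomial''.1
    (inferInstance : Algebra.FiniteType k A)
  obtain ⟨g, rfl⟩ := hf c
  have hp : (RingHom.ker f).IsPrime := RingHom.ker_isPrime _
  have hg : g ∉ vanishingIdeal k (zeroLocus k (RingHom.ker f)) := by
    rw [MvPolynomial.IsPrime.vanishingIdeal_zeroLocus]
    exact hc
  rw [mem_vanishingIdeal_iff] at hg
  push Not at hg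
  obtain ⟨x, hx, hgx⟩ := hg
  refine ⟨Ideal.Quotient.liftₐ (RingHom.ker f) (aeval x) (fun a ha => hx a ha) |>.comp
    (Ideal.quotientKerAlgEquivOfSurjective hf).symm.toAlgHom, ?_⟩
  have : (Ideal.quotientKerAlgEquivOfSurjective hf).symm (f g) =
      Ideal.Quotient.mk (RingHom.ker f) g := by
    rw [AlgEquiv.symm_apply_eq]
    rfl
  simpa [this] using hgx

end Nullstellensatz

section ChainRule

variable {k : Type*} [CommRing k] {σ : Type*} [Fintype σ] {A : Type*} [CommRing A] [Algebra k A]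

theorem derivation_aeval (D : Derivation k A A) (y : σ → A) (G : MvPolynomial σ k) :
    D (aeval y G) = ∑ i, aeval y (pderiv i G) * D (y i) := by
  classical
  induction G using MvPolynomial.induction_on with
  | C c => simp
  | add p q hp hq => simp [hp, hq, add_mul, Finset.sum_add_distrib]
  | mul_X p i hp =>
    have : ∀ j, aeval y (pderiv j (p * X i)) * D (y j) =
        (if j = i then aeval y p * D (y i) else 0) + y i * (aeval y (pderiv j p) * D (y j)) := by
      intro j
      rcases eq_or_ne j i with rfl | h
      · simp
        ring
      · simp [pderiv_X_of_ne h.symm, h]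
        ring
    rw [Finset.sum_congr rfl fun j _ => this j, Finset.sum_add_distrib, ← Finset.mul_sum, ← hp]
    simp

end ChainRule

/-! ### Rational maps and their generic points. -/

section PlaneMapBasics

variable {k : Type u} [Field k]

namespace PlaneMap

/-- Clearing denominators in `G ∘ P`. -/
theorem exists_clear (P : PlaneMap k) (G : MvPolynomial (Fin 3) k) :
    ∃ (g : MvPolynomial (Fin 2) k) (N : ℕ), ∀ (L : Type u) [CommRing L] [Algebra k L] (a b : L)
      (y : Fin 3 → L), (∀ i, y i * aeval ![a, b] P.den = aeval ![a, b] (P.num i)) →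
      aeval y G * aeval ![a, b] P.den ^ N = aeval ![a, b] g := by
  induction G using MvPolynomial.induction_on with
  | C c => exact ⟨C c, 0, fun L _ _ a b y _ => by simp⟩
  | add p q hp hq =>
    obtain ⟨g, N, h⟩ := hp
    obtain ⟨g', N', h'⟩ := hq
    refine ⟨g * P.den ^ N' + g' * P.den ^ N, N + N', fun L _ _ a b y hy => ?_⟩
    rw [map_add, map_add, map_mul, map_mul, ← h L a b y hy, ← h' L a b y hy, map_pow, map_pow]
    ring
  | mul_X p i hp =>
    obtain ⟨g, N, h⟩ := hp
    refine ⟨g * P.num i, N + 1, fun L _ _ a b y hy => ?_⟩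
    rw [map_mul, map_mul, ← h L a b y hy, ← hy i, aeval_X]
    ring

theorem evalAt_mul_den (P : PlaneMap k) {L : Type*} [Field L] [Algebra k L] {a b : L}
    (h : aeval ![a, b] P.den ≠ 0) (i : Fin 3) :
    P.evalAt a b i * aeval ![a, b] P.den = aeval ![a, b] (P.num i) :=
  div_mul_cancel₀ _ h

theorem aeval_generic (g : MvPolynomial (Fin 2) k) :
    aeval ![FunField.s k, FunField.t k] g = algebraMap _ (FunField k) g := by
  have : (aeval ![FunField.s k, FunField.t k] : MvPolynomial (Fin 2) k →ₐ[k] FunField k) =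
      IsScalarTower.toAlgHom k (MvPolynomial (Fin 2) k) (FunField k) := by
    ext i
    fin_cases i <;> simp [FunField.s, FunField.t]
  rw [this]
  rfl

theorem aeval_generic_ne_zero {g : MvPolynomial (Fin 2) k} (hg : g ≠ 0) :
    aeval ![FunField.s k, FunField.t k] g ≠ 0 := by
  rw [aeval_generic]
  exact (map_ne_zero_iff _ (IsFractionRing.injective _ _)).2 hg

/-- A polynomial that vanishes at the generic point of `P` vanishes at every point of `P`. -/
theorem aeval_eq_zero_of_generic {P : PlaneMap k} {G : MvPolynomial (Fin 3) k}
    (h : aeval (P.evalAt (FunField.s k) (FunField.t k)) G = 0)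
    {L : Type u} [CommRing L] [IsDomain L] [Algebra k L] {a b : L} {y : Fin 3 → L}
    (hy : ∀ i, y i * aeval ![a, b] P.den = aeval ![a, b] (P.num i))
    (hd : aeval ![a, b] P.den ≠ 0) : aeval y G = 0 := by
  obtain ⟨g, N, hg⟩ := P.exists_clear G
  have h1 := hg (FunField k) _ _ _ (P.evalAt_mul_den (aeval_generic_ne_zero P.den_ne_zero))
  rw [h, zero_mul] at h1
  have hg0 : g = 0 := by
    by_contra hne
    exact aeval_generic_ne_zero hne h1.symm
  have h2 := hg L a b y hy
  rw [hg0, map_zero] at h2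
  exact (mul_eq_zero.1 h2).resolve_right (pow_ne_zero _ hd)

theorem vec_eta {L : Type*} (x : Fin 2 → L) : ![x 0, x 1] = x := by
  ext i; fin_cases i <;> rfl

/-- A polynomial that vanishes on a dense set of points of `P` vanishes at its generic point. -/
theorem generic_eq_zero_of_dense [Infinite k] {P : PlaneMap k} {G : MvPolynomial (Fin 3) k}
    {h : MvPolynomial (Fin 2) k} (hh : h ≠ 0)
    (H : ∀ a b : k, aeval ![a, b] P.den ≠ 0 → aeval ![a, b] h ≠ 0 →
      aeval (P.evalAt a b) G = 0) :
    aeval (P.evalAt (FunField.s k) (FunField.t k)) G = 0 := by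
  obtain ⟨g, N, hg⟩ := P.exists_clear G
  have hg0 : g * (P.den * h) = 0 := by
    refine MvPolynomial.funext fun x => ?_
    rw [map_zero, map_mul, map_mul]
    by_contra hne
    obtain ⟨h1, h2⟩ := not_or.1 (mt mul_eq_zero.2 hne)
    obtain ⟨h3, h4⟩ := not_or.1 (mt mul_eq_zero.2 h2)
    have := H (x 0) (x 1) (by rw [vec_eta]; simpa using h3) (by rw [vec_eta]; simpa using h4)
    have h5 := hg k (x 0) (x 1) _ (P.evalAt_mul_den (by rw [vec_eta]; simpa using h3))
    rw [this, zero_mul, vec_eta] at h5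
    exact h1 (by simpa using h5.symm)
  have hg1 : g = 0 := (mul_eq_zero.1 hg0).resolve_right (mul_ne_zero P.den_ne_zero hh)
  have h2 := hg _ _ _ _ (P.evalAt_mul_den (aeval_generic_ne_zero P.den_ne_zero))
  rw [hg1, map_zero] at h2
  exact (mul_eq_zero.1 h2).resolve_right (pow_ne_zero _ (aeval_generic_ne_zero P.den_ne_zero))

theorem mem_vanishingIdeal_image_iff [Infinite k] {P : PlaneMap k} {G : MvPolynomial (Fin 3) k} :
    G ∈ vanishingIdeal k P.image ↔ aeval (P.evalAt (FunField.s k) (FunField.t k)) G = 0 := by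
  rw [mem_vanishingIdeal_iff]
  constructor
  · intro h
    exact generic_eq_zero_of_dense (h := 1) one_ne_zero fun a b hd _ => h _ ⟨a, b, hd, rfl⟩
  · rintro h x ⟨a, b, hd, rfl⟩
    exact aeval_eq_zero_of_generic h (P.evalAt_mul_den hd) hd

/-- The ideal of the surface is the kernel of evaluation at the generic point over `k(s,t)`. Through
this, statements about general points become divisibility by `F`. -/
theorem dvd_iff_of_parametrizes [IsAlgClosed k] {P : PlaneMap k} {F : MvPolynomial (Fin 3) k}
    (hF : Irreducible F) (hP : P.Parametrizes {x | eval x F = 0}) {G : MvPolynomial (Fin 3) k} :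
    F ∣ G ↔ aeval (P.evalAt (FunField.s k) (FunField.t k)) G = 0 := by
  rw [← mem_vanishingIdeal_image_iff]
  constructor
  · rintro ⟨c, rfl⟩
    rw [mem_vanishingIdeal_iff]
    intro x hx
    have : x ∈ {x | eval x F = 0} := hP ▸ zeroLocus_vanishingIdeal_le P.image hx
    rw [Set.mem_ofPred_eq] at this
    simp [this]
  · intro h
    refine dvd_of_eval_eq_zero hF fun x hx => ?_
    have : x ∈ {x | eval x F = 0} := hx
    rw [← hP] at this
    simpa using this G h

theorem parametrizes_of_dvd_iff [IsAlgClosed k] {P : PlaneMap k} {F : MvPolynomial (Fin 3) k}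
    (h : ∀ G, aeval (P.evalAt (FunField.s k) (FunField.t k)) G = 0 ↔ F ∣ G) :
    P.Parametrizes {x | eval x F = 0} := by
  ext x
  constructor
  · intro hx
    simpa using hx F (mem_vanishingIdeal_image_iff.2 ((h F).2 dvd_rfl))
  · intro hx G hG
    obtain ⟨c, rfl⟩ := (h G).1 (mem_vanishingIdeal_image_iff.1 hG)
    rw [Set.mem_ofPred_eq] at hx
    simp [hx]

theorem eval_image_eq_zero [IsAlgClosed k] {P : PlaneMap k} {F : MvPolynomial (Fin 3) k}
    (hP : P.Parametrizes {x | eval x F = 0}) {x : Fin 3 → k} (hx : x ∈ P.image) :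
    eval x F = 0 := by
  have : x ∈ {x | eval x F = 0} := hP ▸ zeroLocus_vanishingIdeal_le P.image hx
  exact this

end PlaneMap

end PlaneMapBasics

end RuledSurface

namespace RuledSurface

open MvPolynomial

universe u

/-! ### Dimension counts by transcendence degree. -/

section TranscendenceDegree

variable {k : Type*} [Field k] {A B : Type*} [CommRing A] [IsDomain A] [CommRing B]
  [Algebra k A] [Algebra k B]

/-- Lifting an algebraically independent family along a homomorphism with a nonzero element `g` in
its kernel, one may adjoin `g` to the family. -/
theorem algebraicIndependent_option_of_map {ι : Type*} (f : A →ₐ[k] B) {x : ι → A}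
    (hx : AlgebraicIndependent k (fun i => f (x i))) {g : A} (hg : g ≠ 0) (hfg : f g = 0) :
    AlgebraicIndependent k (fun o : Option ι => o.elim g x) := by
  have hx' : AlgebraicIndependent k x := AlgebraicIndependent.of_comp f hx
  refine (hx'.option_iff_transcendental g).2 fun halg => ?_
  -- If `g` were algebraic over `k[x]`, it would divide a nonzero `r ∈ k[x]`; then `f r = 0`,
  -- although `f` is injective on `k[x]`.
  obtain ⟨⟨r, hr⟩, hr0, c, hc⟩ := halg.exists_nonzero_dvd (mem_nonZeroDivisors_of_ne_zero hg)
  have hc' : r = g * c := hc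
  rw [Algebra.adjoin_range_eq_range_aeval] at hr
  obtain ⟨H, hH⟩ := hr
  have h0 : aeval (fun i => f (x i)) H = 0 := by
    have : f (aeval x H) = 0 := by
      rw [show aeval x H = r from hH, hc', map_mul, hfg, zero_mul]
    rwa [← AlgHom.comp_apply, comp_aeval] at this
  have hH0 : H = 0 := (algebraicIndependent_iff.1 hx) H h0
  refine hr0 (Subtype.ext ?_)
  change r = 0
  rw [← show aeval x H = r from hH, hH0, map_zero]

/-- In the ring `k[x, y, z]`, a prime ideal larger than `(F)` leaves no two algebraically
independent elements. -/
theorem not_algebraicIndependent_of_not_dvd [IsDomain B] {F G : MvPolynomial (Fin 3) k}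
    (hF : Irreducible F) (hFG : ¬ F ∣ G) (f : MvPolynomial (Fin 3) k →ₐ[k] B) (hfF : f F = 0)
    (hfG : f G = 0) (x : Fin 2 → MvPolynomial (Fin 3) k) :
    ¬ AlgebraicIndependent k (fun i => f (x i)) := by
  intro h
  let I : Ideal (MvPolynomial (Fin 3) k) := Ideal.span {F}
  have : I.IsPrime := (Ideal.span_singleton_prime hF.ne_zero).2 hF.prime
  let f₁ : MvPolynomial (Fin 3) k →ₐ[k] MvPolynomial (Fin 3) k ⧸ I := Ideal.Quotient.mkₐ k I
  have hle : ∀ a ∈ I, f a = 0 := by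
    intro a ha
    obtain ⟨c, rfl⟩ := Ideal.mem_span_singleton.1 ha
    rw [map_mul, hfF, zero_mul]
  -- The chain `0 ⊂ (F) ⊂ ker f` is climbed through the quotient by `F`. Each of its two steps adds
  -- one independent element, so two independent elements in the image would give four in `k[x, y,
  -- z]`.
  let f₂ : MvPolynomial (Fin 3) k ⧸ I →ₐ[k] B := Ideal.Quotient.liftₐ I f hle
  have h2 : AlgebraicIndependent k (fun i => f₂ (f₁ (x i))) := h
  have hG : f₁ G ≠ 0 := fun h0 =>
    hFG (Ideal.mem_span_singleton.1 (Ideal.Quotient.eq_zero_iff_mem.1 h0))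
  have h3 := algebraicIndependent_option_of_map f₂ h2 hG hfG
  have h4 : AlgebraicIndependent k (fun o : Option (Fin 2) => f₁ (o.elim G x)) := by
    convert h3 using 2 with o
    cases o <;> rfl
  have h5 := algebraicIndependent_option_of_map f₁ h4 hF.ne_zero
    (Ideal.Quotient.eq_zero_iff_mem.2 (Ideal.mem_span_singleton_self F))
  have h6 := h5.lift_cardinalMk_le_trdeg
  rw [MvPolynomial.trdeg_of_isDomain] at h6
  simp at h6
  norm_cast at h6

end TranscendenceDegree

/-! ### Families of lines and when they fill the surface. -/

section Ruled

variable {k : Type u} [Field k]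

namespace RuledForm

/-- The value of a triple in ruled form at `(a, t)`. -/
noncomputable def point (Q : RuledForm k) {L : Type*} [Field L] [Algebra k L] (a t : L) :
    Fin 3 → L :=
  fun i => (Polynomial.aeval a (Q.r i) + t * Polynomial.aeval a (Q.p i)) / Polynomial.aeval a Q.q

theorem aeval_comp_X {L : Type*} [CommRing L] [Algebra k L] (a b : L) (f : Polynomial k) :
    MvPolynomial.aeval ![a, b] (Polynomial.aeval (X 0 : MvPolynomial (Fin 2) k) f) =
      Polynomial.aeval a f := by
  rw [← Polynomial.aeval_algHom_apply]
  simp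

theorem aeval_den (Q : RuledForm k) {L : Type*} [CommRing L] [Algebra k L] (a b : L) :
    MvPolynomial.aeval ![a, b] Q.toPlaneMap.den = Polynomial.aeval a Q.q :=
  aeval_comp_X a b _

theorem evalAt_toPlaneMap (Q : RuledForm k) {L : Type*} [Field L] [Algebra k L] (a b : L) :
    Q.toPlaneMap.evalAt a b = Q.point a b := by
  ext i
  simp [PlaneMap.evalAt, point, toPlaneMap, aeval_comp_X]

theorem point_mem_image (Q : RuledForm k) {a : k} (ha : Q.q.eval a ≠ 0) (t : k) :
    Q.point a t ∈ Q.toPlaneMap.image :=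
  ⟨a, t, by rw [aeval_den]; simpa using ha, by rw [evalAt_toPlaneMap]⟩

theorem exists_of_mem_image {Q : RuledForm k} {x : Fin 3 → k} (hx : x ∈ Q.toPlaneMap.image) :
    ∃ a t : k, Q.q.eval a ≠ 0 ∧ x = Q.point a t := by
  obtain ⟨a, t, h, rfl⟩ := hx
  rw [aeval_den] at h
  exact ⟨a, t, by simpa using h, evalAt_toPlaneMap Q a t⟩

end RuledForm

/-- A rational function in one variable whose values are roots of a fixed polynomial is
constant. -/
theorem exists_eq_C_mul [IsAlgClosed k] {n d h : Polynomial k} (hd : d ≠ 0) (hh : h ≠ 0)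
    (H : ∀ a, d.eval a ≠ 0 → h.eval (n.eval a / d.eval a) = 0) :
    ∃ c, n = Polynomial.C c * d := by
  -- Each value `n(a)/d(a)` is one of the finitely many roots `c` of `h`, so the product of all `n -
  -- c d` vanishes wherever `d` does not.
  have h0 : d * (h.roots.map fun c => n - Polynomial.C c * d).prod = 0 := by
    refine Polynomial.funext fun a => ?_
    rw [Polynomial.eval_mul, Polynomial.eval_zero]
    by_cases hda : d.eval a = 0
    · rw [hda, zero_mul]
    · rw [Polynomial.eval_multiset_prod, Multiset.prod_eq_zero, mul_zero]
      rw [Multiset.map_map, Multiset.mem_map]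
      refine ⟨n.eval a / d.eval a, (Polynomial.mem_roots hh).2 (H a hda), ?_⟩
      simp [div_mul_cancel₀ _ hda]
  have h1 := Multiset.prod_eq_zero_iff.1 ((mul_eq_zero.1 h0).resolve_left hd)
  obtain ⟨c, -, hc⟩ := Multiset.mem_map.1 h1
  exact ⟨c, sub_eq_zero.1 hc⟩

theorem exists_eval_ne_zero {σ : Type*} {R : Type*} [CommRing R] [IsDomain R] [Infinite R]
    {G : MvPolynomial σ R} (hG : G ≠ 0) : ∃ x, eval x G ≠ 0 := by
  by_contra! h
  exact hG (MvPolynomial.funext fun x => by simpa using h x)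

/-- A triple in ruled form whose coordinates `i` and `j` satisfy an algebraic relation: the
projections of all the lines to the plane of these two coordinates are the same. -/
theorem RuledForm.exists_projection_eq [IsAlgClosed k] (Q : RuledForm k) {i j : Fin 3}
    (hi : Q.p i ≠ 0) {H : MvPolynomial (Fin 2) k} (hH : H ≠ 0)
    (hQ : ∀ x ∈ Q.toPlaneMap.image, eval ![x i, x j] H = 0) :
    ∃ α γ : k, Q.p j = Polynomial.C γ * Q.p i ∧
      Q.r j = Polynomial.C γ * Q.r i + Polynomial.C α * Q.q := by
  -- The line over `a` meets the plane `xᵢ = z` in a point whose `j`-th coordinate is a rational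
  -- function of `a` and a root of `H(z, ·)`, hence a constant `c`. Two values of `z` then determine
  -- the slope and intercept of the common projection.
  have key : ∀ z w : k, eval ![z, w] H ≠ 0 →
      ∃ c, Q.r j * Q.p i - Q.r i * Q.p j + Polynomial.C z * Q.q * Q.p j =
        Polynomial.C c * (Q.q * Q.p i) := by
    intro z w hzw
    let h : Polynomial k := MvPolynomial.aeval ![Polynomial.C z, Polynomial.X] H
    have heval : ∀ y, h.eval y = eval ![z, y] H := by
      intro y
      have : Polynomial.aeval y h = MvPolynomial.aeval ![z, y] H := by
        simp only [h]
        rw [← AlgHom.comp_apply, comp_aeval]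
        congr 2
        ext l
        fin_cases l <;> simp
      simpa using this
    refine exists_eq_C_mul (h := h) (mul_ne_zero Q.q_ne_zero hi) ?_ ?_
    · rintro h0
      exact hzw (by rw [← heval, h0, Polynomial.eval_zero])
    · intro a ha
      rw [Polynomial.eval_mul] at ha
      obtain ⟨hq, hp⟩ := not_or.1 (mt mul_eq_zero.2 ha)
      have := hQ _ (Q.point_mem_image hq ((z * Q.q.eval a - (Q.r i).eval a) / (Q.p i).eval a))
      rw [heval]
      convert this using 3
      ext l
      fin_cases l
      · simp [RuledForm.point]
        field_simp
        ring
      · simp [RuledForm.point]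
        field_simp
        ring
  obtain ⟨x, hx⟩ := exists_eval_ne_zero hH
  have hH' : H * (X 0 - C (x 0)) ≠ 0 := by
    refine mul_ne_zero hH fun h0 => ?_
    have := congrArg (eval fun _ => x 0 + 1) h0
    simp at this
  obtain ⟨y, hy⟩ := exists_eval_ne_zero hH'
  rw [map_mul] at hy
  obtain ⟨hy1, hy2⟩ := not_or.1 (mt mul_eq_zero.2 hy)
  obtain ⟨c, hc⟩ := key (x 0) (x 1) (by rwa [PlaneMap.vec_eta])
  obtain ⟨d, hd⟩ := key (y 0) (y 1) (by rwa [PlaneMap.vec_eta])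
  have hyx : y 0 - x 0 ≠ 0 := by simpa using hy2
  have hp : Q.p j = Polynomial.C ((d - c) / (y 0 - x 0)) * Q.p i := by
    refine mul_left_cancel₀ (mul_ne_zero Q.q_ne_zero (Polynomial.C_ne_zero.2 hyx)) ?_
    have : Polynomial.C (y 0 - x 0) * Polynomial.C ((d - c) / (y 0 - x 0)) =
        Polynomial.C (d - c) := by
      rw [← Polynomial.C_mul, mul_div_cancel₀ _ hyx]
    have h2 : Q.q * Polynomial.C (y 0 - x 0) * Q.p j = Polynomial.C (d - c) * (Q.q * Q.p i) := by
      rw [Polynomial.C_sub, Polynomial.C_sub]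
      linear_combination hd - hc
    rw [h2, ← this]
    ring
  refine ⟨c - x 0 * ((d - c) / (y 0 - x 0)), (d - c) / (y 0 - x 0), hp, ?_⟩
  refine mul_left_cancel₀ hi ?_
  rw [hp] at hc
  rw [Polynomial.C_sub, Polynomial.C_mul]
  linear_combination hc

/-- A family of lines in an irreducible surface, parametrized by the affine line and not constant,
parametrizes the surface. -/
theorem RuledForm.parametrizes_of_ne [IsAlgClosed k] {F : MvPolynomial (Fin 3) k}
    (hF : Irreducible F) (Q : RuledForm k)
    (hQ : ∀ a t, Q.q.eval a ≠ 0 → eval (Q.point a t) F = 0) {a b t : k} (ha : Q.q.eval a ≠ 0)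
    (hb : Q.q.eval b ≠ 0) {i : Fin 3} (hi : (Q.p i).eval a ≠ 0)
    (hne : ∀ u, Q.point a u ≠ Q.point b t) :
    Q.toPlaneMap.Parametrizes {x | eval x F = 0} := by
  have hFI : F ∈ vanishingIdeal k Q.toPlaneMap.image := by
    rw [mem_vanishingIdeal_iff]
    intro x hx
    obtain ⟨a, t, ha, rfl⟩ := exists_of_mem_image hx
    simpa using hQ a t ha
  refine PlaneMap.parametrizes_of_dvd_iff fun G => ?_
  constructor
  · intro hG
    by_contra hFG
    -- A further equation `G` makes the closure of the family at most a curve, so the coordinates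
    -- `i` and `j` are algebraically related.
    have hrel : ∀ j, ∃ α γ : k, Q.p j = Polynomial.C γ * Q.p i ∧
        Q.r j = Polynomial.C γ * Q.r i + Polynomial.C α * Q.q := by
      intro j
      have hnot := not_algebraicIndependent_of_not_dvd hF hFG
        (aeval (Q.toPlaneMap.evalAt (FunField.s k) (FunField.t k)))
        (PlaneMap.mem_vanishingIdeal_image_iff.1 hFI) hG ![X i, X j]
      rw [algebraicIndependent_iff] at hnot
      push Not at hnot
      obtain ⟨H, hH, hH0⟩ := hnot
      refine Q.exists_projection_eq (fun h0 => hi (by simp [h0])) hH0 fun x hx => ?_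
      rw [← MvPolynomial.comp_aeval_apply] at hH
      have := (mem_vanishingIdeal_iff.1 (PlaneMap.mem_vanishingIdeal_image_iff.2 hH)) x hx
      rw [MvPolynomial.comp_aeval_apply] at this
      have he : (fun l => aeval x ((![X i, X j] : Fin 2 → MvPolynomial (Fin 3) k) l)) =
          ![x i, x j] := by
        ext l
        fin_cases l <;> simp
      rw [he] at this
      simpa using this
    choose α γ hp hr using hrel
    -- This parameter gives the point on the line over `a` with the same `i`-th coordinate as the
    -- point over `b`; the relations then make the other coordinates agree.
    refine hne ((Q.point b t i * Q.q.eval a - (Q.r i).eval a) / (Q.p i).eval a) (funext fun j => ?_)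
    simp only [point, Polynomial.coe_aeval_eq_eval]
    rw [hp j, hr j]
    simp only [Polynomial.eval_add, Polynomial.eval_mul, Polynomial.eval_C]
    field_simp
    ring
  · rintro ⟨c, rfl⟩
    rw [map_mul, PlaneMap.mem_vanishingIdeal_image_iff.1 hFI, zero_mul]

end Ruled

end RuledSurface

namespace RuledSurface

universe u

/-! ### A ruled form of a surface depends on `t`. -/

section Degenerate

open MvPolynomial

variable {k : Type u} [Field k]

/-- A nonconstant polynomial cannot divide, for each variable, a nonzero polynomial that does not
involve this variable. -/
theorem not_irreducible_of_dvd {F : MvPolynomial (Fin 3) k}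
    (h : ∀ l, ∃ G, G ≠ 0 ∧ F ∣ G ∧ l ∉ G.vars) : ¬ Irreducible F := by
  intro hF
  have hv : F.vars = ∅ := by
    refine Finset.eq_empty_of_forall_notMem fun l hl => ?_
    obtain ⟨G, hG, ⟨c, rfl⟩, hlG⟩ := h l
    rw [mem_vars_iff_degreeOf_ne_zero] at hl hlG
    rw [degreeOf_mul_eq hF.ne_zero (right_ne_zero_of_mul hG)] at hlG
    omega
  have hC := vars_eq_empty_iff_eq_C.1 hv
  refine hF.not_isUnit ?_
  rw [hC]
  refine (IsUnit.mk0 _ fun h0 => hF.ne_zero ?_).map C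
  rw [hC, h0, C_0]

theorem exists_ne_ne (l : Fin 3) : ∃ i j : Fin 3, i ≠ l ∧ j ≠ l ∧ i ≠ j := by
  fin_cases l
  · exact ⟨1, 2, by decide, by decide, by decide⟩
  · exact ⟨0, 2, by decide, by decide, by decide⟩
  · exact ⟨0, 1, by decide, by decide, by decide⟩

theorem notMem_vars_rename {i j l : Fin 3} (hi : i ≠ l) (hj : j ≠ l) (H : MvPolynomial (Fin 2) k) :
    l ∉ (rename ![i, j] H).vars := by
  intro hl
  obtain ⟨m, -, hm⟩ := mem_vars_rename _ _ hl
  fin_cases m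
  · exact hi hm
  · exact hj hm

theorem injective_vec {i j : Fin 3} (h : i ≠ j) : Function.Injective ![i, j] := by
  intro a b hab
  fin_cases a <;> fin_cases b <;> simp_all [Ne.symm h]

theorem trdeg_fractionRing_polynomial :
    Algebra.trdeg k (FractionRing (Polynomial k)) = 1 := by
  have : Algebra.IsAlgebraic (Polynomial k) (FractionRing (Polynomial k)) :=
    IsLocalization.isAlgebraic _ (nonZeroDivisors (Polynomial k))
  rw [← trdeg_add_eq k (Polynomial k) (A := FractionRing (Polynomial k)),
    Polynomial.trdeg_of_isDomain, trdeg_eq_zero, add_zero]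

theorem transcendental_s : Transcendental k (FunField.s k) :=
  (transcendental_algebraMap_iff (IsFractionRing.injective _ _)).2 (transcendental_X k 0)

theorem aeval_s_ne_zero {f : Polynomial k} (hf : f ≠ 0) : Polynomial.aeval (FunField.s k) f ≠ 0 :=
  fun h => hf (transcendental_iff.1 transcendental_s f h)

/-- A parametrization of a surface in ruled form depends on the second parameter. -/
theorem RuledForm.exists_p_ne_zero [IsAlgClosed k] {F : MvPolynomial (Fin 3) k}
    (hF : Irreducible F) {P : RuledForm k} (hP : P.toPlaneMap.Parametrizes {x | eval x F = 0}) :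
    ∃ i, P.p i ≠ 0 := by
  by_contra! hp
  refine not_irreducible_of_dvd (fun l => ?_) hF
  obtain ⟨i, j, hi, hj, hij⟩ := exists_ne_ne l
  let K := FractionRing (Polynomial k)
  let y : Fin 3 → K := fun i => algebraMap (Polynomial k) K (P.r i) / algebraMap (Polynomial k) K P.q
  -- With all `pᵢ = 0` the coordinates lie in `k(s)`, of transcendence degree one. A relation
  -- between the coordinates `i` and `j` is a multiple of `F` free of the variable `l`.
  have hnot : ¬ AlgebraicIndependent k (fun l => y (![i, j] l)) := by
    intro h
    have := h.lift_cardinalMk_le_trdeg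
    rw [trdeg_fractionRing_polynomial] at this
    simp at this
  rw [algebraicIndependent_iff] at hnot
  push Not at hnot
  obtain ⟨H, hH, hH0⟩ := hnot
  refine ⟨rename ![i, j] H, fun h0 => hH0 ?_, ?_, notMem_vars_rename hi hj H⟩
  · exact rename_injective _ (injective_vec hij) (by rw [h0, map_zero])
  · rw [PlaneMap.dvd_iff_of_parametrizes hF hP, aeval_rename]
    have hinj : Function.Injective (Polynomial.aeval (FunField.s k) : Polynomial k →ₐ[k] _) :=
      transcendental_iff_injective.1 transcendental_s
    let ψ : K →ₐ[k] FunField k := IsFractionRing.liftAlgHom (K := K) hinj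
    have hψ : ∀ f, ψ (algebraMap (Polynomial k) K f) = Polynomial.aeval (FunField.s k) f := fun f =>
      IsFractionRing.lift_algebraMap hinj f
    have := congrArg ψ hH
    rw [map_zero, MvPolynomial.comp_aeval_apply] at this
    convert this using 3
    ext l
    simp [RuledForm.evalAt_toPlaneMap, RuledForm.point, y, hψ, hp]

end Degenerate

/-! ### Standardization by inversion of `s` and removal of a gcd. -/

section Standardize

variable {k : Type u} [Field k]

open Polynomial

/-- The polynomial `X ^ N * f (a + 1 / X)`. -/
noncomputable def invert (N : ℕ) (a : k) (f : k[X]) : k[X] := (f.comp (X + C a)).reflect N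

theorem aeval_invert {L : Type*} [Field L] [Algebra k L] {N : ℕ} (a : k) {f : k[X]}
    (hf : f.natDegree ≤ N) {z : L} (hz : z ≠ 0) :
    aeval z (invert N a f) = z ^ N * aeval (algebraMap k L a + z⁻¹) f := by
  have hz' : z⁻¹ ≠ 0 := inv_ne_zero hz
  let _ := invertibleOfNonzero hz'
  have h := eval₂_reflect_mul_pow (algebraMap k L) z⁻¹ N (f.comp (X + C a))
    (by rwa [natDegree_comp, natDegree_X_add_C, mul_one])
  rw [invOf_eq_inv, inv_inv] at h
  have h2 : eval₂ (algebraMap k L) z⁻¹ (f.comp (X + C a)) =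
      aeval (algebraMap k L a + z⁻¹) f := by
    rw [← aeval_def, aeval_comp]
    simp [add_comm]
  rw [← h2, ← h, invert, aeval_def, mul_left_comm, ← mul_pow, mul_inv_cancel₀ hz, one_pow, mul_one]

theorem invert_ne_zero {N : ℕ} {a : k} {f : k[X]} (hf : f ≠ 0) : invert N a f ≠ 0 := by
  rw [invert, Ne, reflect_eq_zero_iff, comp_X_add_C_eq_zero_iff]
  exact hf

/-- Reflection moves the constant term `f(a)` of the shifted polynomial to the coefficient of `X ^
N`. -/
theorem natDegree_invert {N : ℕ} {a : k} {f : k[X]} (hf : f.natDegree ≤ N) (ha : f.eval a ≠ 0) :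
    (invert N a f).natDegree = N := by
  apply le_antisymm
  · refine natDegree_reflect_le.trans ?_
    rw [natDegree_comp, natDegree_X_add_C, mul_one]
    exact max_le le_rfl hf
  · apply le_natDegree_of_ne_zero
    rw [invert, coeff_reflect, revAt_le le_rfl, Nat.sub_self, coeff_zero_eq_eval_zero, eval_comp]
    simpa using ha

/-- `Δ` generates the ideal of the `f i`; by Bézout the quotients generate the unit ideal, which
excludes a common root. -/
theorem exists_common_divisor {ι : Type*} [Fintype ι] (f : ι → k[X]) (hf : ∃ i, f i ≠ 0) :
    ∃ (Δ : k[X]) (g : ι → k[X]), Δ ≠ 0 ∧ (∀ i, f i = Δ * g i) ∧ ¬ ∃ z, ∀ i, (g i).IsRoot z := by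
  obtain ⟨Δ, hΔ⟩ := (inferInstance : (Ideal.span (Set.range f)).IsPrincipal)
  rw [Ideal.submodule_span_eq] at hΔ
  have hdvd : ∀ i, ∃ g, f i = Δ * g := fun i =>
    Ideal.mem_span_singleton.1 (hΔ ▸ Ideal.subset_span (Set.mem_range_self i))
  choose g hg using hdvd
  have hΔ0 : Δ ≠ 0 := by
    rintro rfl
    obtain ⟨i, hi⟩ := hf
    exact hi (by rw [hg i, zero_mul])
  refine ⟨Δ, g, hΔ0, hg, ?_⟩
  rintro ⟨z, hz⟩
  have hmem : Δ ∈ Ideal.span (Set.range f) := hΔ ▸ Ideal.mem_span_singleton_self Δ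
  obtain ⟨c, hc⟩ := (Ideal.mem_span_range_iff_exists_fun).1 hmem
  have h1 : ∑ i, c i * g i = 1 := by
    refine mul_left_cancel₀ hΔ0 ?_
    rw [mul_one, Finset.mul_sum]
    refine Eq.trans ?_ hc
    exact Finset.sum_congr rfl fun i _ => by rw [hg i]; ring
  have := congrArg (eval z) h1
  rw [eval_finsetSum, Finset.sum_eq_zero, eval_one] at this
  · exact zero_ne_one this
  · intro i _
    rw [eval_mul, (hz i : eval z (g i) = 0), mul_zero]

/-- Every triple in ruled form that depends on the second parameter can be standardized. -/
theorem RuledForm.exists_isStandardized [IsAlgClosed k] {S : Set (Fin 3 → k)} {P : RuledForm k}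
    (hP : P.toPlaneMap.Parametrizes S) (hp : ∃ i, P.p i ≠ 0) :
    ∃ Q : RuledForm k, Q.IsStandardized S ∧ IsReparametrization Q.toPlaneMap P.toPlaneMap := by
  classical
  obtain ⟨a, ha⟩ : ∃ a, ∀ i, P.p i ≠ 0 → (P.p i).eval a ≠ 0 := by
    have hne : (∏ i, if P.p i = 0 then 1 else P.p i) ≠ 0 := by
      rw [Finset.prod_ne_zero_iff]
      intro i _
      split_ifs with h
      exacts [one_ne_zero, h]
    obtain ⟨a, ha⟩ := Polynomial.exists_eval_ne_zero_of_natDegree_lt_card _ hne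
      ((Cardinal.natCast_lt_aleph0).trans_le (Cardinal.aleph0_le_mk k))
    refine ⟨a, fun i hi h0 => ha ?_⟩
    rw [eval_prod]
    exact Finset.prod_eq_zero (Finset.mem_univ i) (by rw [if_neg hi, h0])
  obtain ⟨N, hN⟩ : ∃ N, P.q.natDegree ≤ N ∧ ∀ i, (P.r i).natDegree ≤ N ∧ (P.p i).natDegree ≤ N := by
    refine ⟨P.q.natDegree + ∑ i, ((P.r i).natDegree + (P.p i).natDegree), by omega, fun i => ?_⟩
    have := Finset.single_le_sum (f := fun i => (P.r i).natDegree + (P.p i).natDegree)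
      (fun _ _ => Nat.zero_le _) (Finset.mem_univ i)
    omega
  obtain ⟨Δ, g, hΔ, hg, hroot⟩ := exists_common_divisor (fun i => invert N a (P.p i))
    (hp.imp fun i hi => invert_ne_zero hi)
  let Q : RuledForm k := ⟨fun i => invert N a (P.r i), g, invert N a P.q, invert_ne_zero P.q_ne_zero⟩
  -- The factor `z ^ N` cancels between numerators and denominator, which leaves only the change of
  -- parameters.
  have hpoint : ∀ (z t : FunField k), z ≠ 0 → aeval z Δ ≠ 0 →
      Q.point z t = P.point (algebraMap k _ a + z⁻¹) (t / aeval z Δ) := by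
    intro z t hz hΔz
    ext i
    have h1 := congrArg (aeval z) (hg i)
    rw [map_mul, aeval_invert a (hN.2 i).2 hz] at h1
    simp only [point, Q]
    rw [aeval_invert a hN.1 hz, aeval_invert a (hN.2 i).1 hz]
    have hzN := pow_ne_zero N hz
    rw [show aeval z (g i) = z ^ N * aeval (algebraMap k (FunField k) a + z⁻¹) (P.p i) / aeval z Δ by
      rw [h1, mul_div_cancel_left₀ _ hΔz]]
    rw [← mul_div_mul_left (_ + t / _ * _) _ hzN]
    congr 1
    ring
  have hs : FunField.s k ≠ 0 := by
    have := aeval_s_ne_zero (k := k) (X_ne_zero)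
    simpa using this
  have hsa : FunField.s k - algebraMap k _ a ≠ 0 := by
    have := aeval_s_ne_zero (k := k) (X_sub_C_ne_zero a)
    simpa using this
  have hz : ∀ f : k[X], f ≠ 0 → aeval (FunField.s k - algebraMap k _ a)⁻¹ f ≠ 0 := by
    intro f hf h0
    refine transcendental_s (k := k) ?_
    have h1 : IsAlgebraic k (FunField.s k - algebraMap k (FunField k) a)⁻¹ := ⟨f, hf, h0⟩
    have h2 := (isAlgebraic_algebraMap (A := FunField k) a).add h1.inv
    simpa using h2
  refine ⟨Q, ⟨?_, ?_, ?_⟩, ?_⟩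
  · rw [← hP, PlaneMap.Parametrizes]
    congr 1
    ext G
    rw [PlaneMap.mem_vanishingIdeal_image_iff, PlaneMap.mem_vanishingIdeal_image_iff]
    constructor
    · intro hG
      -- The inverse change of parameters: `Q` at `(z, t Δ(z))` is `P` at `(s, t)`.
      set z := (FunField.s k - algebraMap k _ a)⁻¹
      have hden : MvPolynomial.aeval ![z, FunField.t k * aeval z Δ] Q.toPlaneMap.den ≠ 0 := by
        rw [aeval_den]
        exact hz _ Q.q_ne_zero
      have h1 := PlaneMap.aeval_eq_zero_of_generic hG
        (Q.toPlaneMap.evalAt_mul_den hden) hden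
      rw [evalAt_toPlaneMap, hpoint _ _ (inv_ne_zero hsa) (hz Δ hΔ),
        mul_div_cancel_right₀ _ (hz Δ hΔ), inv_inv, add_sub_cancel] at h1
      rwa [evalAt_toPlaneMap]
    · intro hG
      have hden : MvPolynomial.aeval ![algebraMap k _ a + (FunField.s k)⁻¹,
          FunField.t k / aeval (FunField.s k) Δ] P.toPlaneMap.den ≠ 0 := by
        rw [aeval_den]
        have := aeval_s_ne_zero Q.q_ne_zero
        rw [show Q.q = invert N a P.q from rfl, aeval_invert a hN.1 hs] at this
        exact right_ne_zero_of_mul this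
      have h1 := PlaneMap.aeval_eq_zero_of_generic hG
        (P.toPlaneMap.evalAt_mul_den hden) hden
      rwa [evalAt_toPlaneMap, ← hpoint _ _ hs (aeval_s_ne_zero hΔ), ← evalAt_toPlaneMap] at h1
  · have hdeg : ∀ i, Q.p i ≠ 0 → Δ.natDegree + (Q.p i).natDegree = N := by
      intro i hi
      have hgi : invert N a (P.p i) = Δ * g i := hg i
      rw [← natDegree_mul hΔ hi, show Δ * Q.p i = invert N a (P.p i) from hgi.symm]
      refine natDegree_invert (hN.2 i).2 (ha i fun h0 => ?_)
      refine mul_ne_zero hΔ hi (hgi.symm.trans ?_)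
      simp [invert, h0]
    intro i j hi hj
    have h1 := hdeg i hi
    have h2 := hdeg j hj
    omega
  · rintro ⟨z, hz'⟩
    refine hroot ⟨z, fun i => ?_⟩
    by_cases h0 : g i = 0
    · rw [h0]
      exact eval_zero
    · exact hz' i h0
  · refine ⟨0, 1, a, 1, 1, 0, Δ, one_ne_zero, by simp, hΔ, _, _, rfl, rfl, ?_⟩
    rw [evalAt_toPlaneMap, evalAt_toPlaneMap, hpoint _ _ hs (aeval_s_ne_zero hΔ)]
    congr 1
    · rw [map_one, map_zero, one_smul, add_zero, Algebra.smul_def, add_div,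
        mul_div_cancel_right₀ _ hs, one_div]
    · rw [zero_smul, zero_add, one_smul]

end Standardize

end RuledSurface

namespace RuledSurface

open MvPolynomial

universe u

/-! ### Tangent fields and the second fundamental form. -/

section SecondOrder

variable {k : Type u} [Field k]

theorem eval_aeval_polynomial {σ : Type*} (y : σ → Polynomial k) (u : k) (G : MvPolynomial σ k) :
    Polynomial.eval u (aeval y G) = eval (fun i => Polynomial.eval u (y i)) G := by
  have := MvPolynomial.comp_aeval_apply y (Polynomial.aeval u) G
  simpa [MvPolynomial.aeval_eq_eval] using this

theorem pderiv_comm {σ : Type*} (i j : σ) (F : MvPolynomial σ k) :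
    pderiv i (pderiv j F) = pderiv j (pderiv i F) := by
  classical
  have : ⁅(pderiv i : Derivation k (MvPolynomial σ k) (MvPolynomial σ k)),
      (pderiv j : Derivation k (MvPolynomial σ k) (MvPolynomial σ k))⁆ = 0 := by
    refine MvPolynomial.derivation_ext fun l => ?_
    rw [Derivation.commutator_apply]
    simp only [pderiv_X, Pi.single_apply]
    split_ifs <;> simp
  have h := congrArg (fun D => D F) this
  simpa [Derivation.commutator_apply, sub_eq_zero] using h

/-- The vector field `(∂ᵢF) a - (a · ∇F) εᵢ`, which is tangent to the level sets of `F`. -/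
noncomputable def tangent (F : MvPolynomial (Fin 3) k) (i : Fin 3) (a : Fin 3 → k) :
    Fin 3 → MvPolynomial (Fin 3) k :=
  fun j => pderiv i F * C (a j) - (∑ l, C (a l) * pderiv l F) * if j = i then 1 else 0

/-- The bilinear form given by the second partial derivatives of `F`. -/
noncomputable def hessian (F : MvPolynomial (Fin 3) k) (v w : Fin 3 → MvPolynomial (Fin 3) k) :
    MvPolynomial (Fin 3) k :=
  ∑ i, ∑ j, v i * w j * pderiv i (pderiv j F)

theorem hessian_comm (F : MvPolynomial (Fin 3) k) (v w : Fin 3 → MvPolynomial (Fin 3) k) :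
    hessian F v w = hessian F w v := by
  rw [hessian, hessian, Finset.sum_comm]
  exact Finset.sum_congr rfl fun i _ => Finset.sum_congr rfl fun j _ => by
    rw [pderiv_comm, mul_comm (v j)]

theorem hessian_add_add (F : MvPolynomial (Fin 3) k) (v w : Fin 3 → MvPolynomial (Fin 3) k) :
    hessian F (v + w) (v + w) = hessian F v v + 2 * hessian F v w + hessian F w w := by
  have : 2 * hessian F v w = hessian F v w + hessian F w v := by rw [two_mul, hessian_comm F w v]
  rw [this]
  simp only [hessian, ← Finset.sum_add_distrib, Pi.add_apply]
  exact Finset.sum_congr rfl fun i _ => Finset.sum_congr rfl fun j _ => by ring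

theorem tangent_add (F : MvPolynomial (Fin 3) k) (i : Fin 3) (a b : Fin 3 → k) :
    tangent F i (a + b) = tangent F i a + tangent F i b := by
  ext1 j
  simp only [tangent, Pi.add_apply, C_add, add_mul, Finset.sum_add_distrib]
  ring

theorem hessian_tangent_single (F : MvPolynomial (Fin 3) k) (i j l : Fin 3) :
    hessian F (tangent F i (Pi.single j 1)) (tangent F i (Pi.single l 1)) =
      pderiv i F ^ 2 * pderiv j (pderiv l F) - pderiv i F * pderiv l F * pderiv j (pderiv i F)
        - pderiv j F * pderiv i F * pderiv i (pderiv l F)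
        + pderiv j F * pderiv l F * pderiv i (pderiv i F) := by
  have h : ∀ j m, tangent F i (Pi.single j 1) m =
      (if m = j then pderiv i F else 0) - if m = i then pderiv j F else 0 := by
    intro j m
    have : ∑ l, C ((Pi.single j 1 : Fin 3 → k) l) * pderiv l F = pderiv j F := by
      rw [Finset.sum_eq_single j]
      · simp
      · intro b _ hb
        simp [hb]
      · simp
    rw [tangent, this, Pi.single_apply]
    split_ifs <;> simp
  simp only [hessian, h, sub_mul, mul_sub, ite_mul, mul_ite, zero_mul, mul_zero,
    Finset.sum_sub_distrib, Finset.sum_ite_eq', Finset.mem_univ, if_true]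
  ring

/-- A line contained in a surface is tangent to it, to the second order. -/
theorem tangent_of_line [Infinite k] {F : MvPolynomial (Fin 3) k} {x v : Fin 3 → k}
    (h : ∀ u : k, eval (x + u • v) F = 0) :
    ∑ i, eval x (pderiv i F) * v i = 0 ∧
      ∑ i, ∑ j, v i * v j * eval x (pderiv i (pderiv j F)) = 0 := by
  let y : Fin 3 → Polynomial k := fun i => Polynomial.C (x i) + Polynomial.X * Polynomial.C (v i)
  have hy : ∀ u G, Polynomial.eval u (aeval y G) = eval (x + u • v) G := by
    intro u G
    rw [eval_aeval_polynomial]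
    congr 2
    ext i
    simp only [y, Polynomial.eval_add, Polynomial.eval_C, Polynomial.eval_mul, Polynomial.eval_X,
      Pi.add_apply, Pi.smul_apply, smul_eq_mul]
  have hd : ∀ G : MvPolynomial (Fin 3) k, Polynomial.derivative (aeval y G) =
      ∑ i, aeval y (pderiv i G) * Polynomial.C (v i) := by
    intro G
    have hy' : ∀ i, Polynomial.derivative (y i) = Polynomial.C (v i) := by
      intro i
      simp [y]
    have := derivation_aeval (Polynomial.derivative' (R := k)) y G
    simpa only [Polynomial.derivative'_apply, hy'] using this
  -- `F` restricted to the line is the zero polynomial; its first two derivatives at `0` give the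
  -- two claims.
  have h0 : aeval y F = 0 := Polynomial.funext fun u => by rw [hy, h, Polynomial.eval_zero]
  have h1 := hd F
  rw [h0, Polynomial.derivative_zero] at h1
  have h2 := congrArg Polynomial.derivative h1
  simp only [Polynomial.derivative_zero, Polynomial.derivative_sum, Polynomial.derivative_mul,
    Polynomial.derivative_C, mul_zero, add_zero, hd] at h2
  constructor
  · have := congrArg (Polynomial.eval 0) h1
    simpa [Polynomial.eval_finsetSum, hy] using this.symm
  · have := congrArg (Polynomial.eval 0) h2
    rw [Finset.sum_comm]
    simp only [Polynomial.eval_finsetSum, Polynomial.eval_mul, Polynomial.eval_zero, hy,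
      Polynomial.eval_C, Finset.sum_mul, zero_smul, add_zero] at this
    rw [this]
    refine Finset.sum_congr rfl fun i _ => Finset.sum_congr rfl fun j _ => ?_
    ring

end SecondOrder

end RuledSurface

namespace RuledSurface

open MvPolynomial

universe u

/-! ### Restriction to lines in the parameter plane. -/

section Path

variable {k : Type u} [Field k]

/-- The restriction of polynomials in two variables to the line through `p` and `p'`. -/
noncomputable def path (p p' : Fin 2 → k) : MvPolynomial (Fin 2) k →ₐ[k] Polynomial k :=
  aeval fun i => Polynomial.C (p i) + Polynomial.C (p' i - p i) * Polynomial.X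

theorem eval_path (p p' : Fin 2 → k) (w : k) (g : MvPolynomial (Fin 2) k) :
    (path p p' g).eval w = eval (fun i => p i + (p' i - p i) * w) g := by
  rw [path, eval_aeval_polynomial]
  simp

theorem eval_zero_path (p p' : Fin 2 → k) (g : MvPolynomial (Fin 2) k) :
    (path p p' g).eval 0 = eval p g := by
  simp [eval_path]

theorem eval_one_path (p p' : Fin 2 → k) (g : MvPolynomial (Fin 2) k) :
    (path p p' g).eval 1 = eval p' g := by
  simp [eval_path]

theorem aeval_vec (p : Fin 2 → k) (g : MvPolynomial (Fin 2) k) :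
    aeval ![p 0, p 1] g = eval p g := by
  rw [PlaneMap.vec_eta, MvPolynomial.aeval_eq_eval]

/-- A surface whose equation does not divide `G` has a parametrized point where `G` is nonzero. -/
theorem PlaneMap.exists_eval_ne_zero [IsAlgClosed k] {P : PlaneMap k} {F G : MvPolynomial (Fin 3) k}
    (hF : Irreducible F) (hP : P.Parametrizes {x | eval x F = 0}) (hG : ¬ F ∣ G)
    {h : MvPolynomial (Fin 2) k} (hh : h ≠ 0) :
    ∃ p : Fin 2 → k, eval p P.den ≠ 0 ∧ eval p h ≠ 0 ∧ eval (P.evalAt (p 0) (p 1)) G ≠ 0 := by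
  by_contra! H
  refine hG ((dvd_iff_of_parametrizes hF hP).2 (generic_eq_zero_of_dense hh fun a b hd hb => ?_))
  rw [MvPolynomial.aeval_eq_eval] at hd hb ⊢
  exact H ![a, b] hd hb

theorem PlaneMap.eval_eq_zero [IsAlgClosed k] {P : PlaneMap k} {F : MvPolynomial (Fin 3) k}
    (hP : P.Parametrizes {x | eval x F = 0}) {p : Fin 2 → k} (hp : eval p P.den ≠ 0) :
    eval (P.evalAt (p 0) (p 1)) F = 0 :=
  eval_image_eq_zero hP ⟨p 0, p 1, by rwa [aeval_vec], rfl⟩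

end Path

/-! ### Surfaces with vanishing second fundamental form are planes. -/

section Plane

variable {k : Type u} [Field k]

theorem constantCoeff_aeval {σ : Type*} (y : σ → PowerSeries k) (G : MvPolynomial σ k) :
    PowerSeries.constantCoeff (aeval y G) =
      eval (fun i => PowerSeries.constantCoeff (y i)) G := by
  rw [map_aeval]
  have : (PowerSeries.constantCoeff (R := k)).comp (algebraMap k (PowerSeries k)) = RingHom.id k := by
    ext a
    simp
  rw [this]
  rfl

/-- The second fundamental form of a surface vanishes identically: along a formal arc, the normal
direction is constant. -/
theorem normal_constant [CharZero k] {F : MvPolynomial (Fin 3) k} {i : Fin 3}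
    (hA : ∀ a b, F ∣ hessian F (tangent F i a) (tangent F i b)) {y : Fin 3 → PowerSeries k}
    (hy : aeval y F = 0) (hi : PowerSeries.constantCoeff (aeval y (pderiv i F)) ≠ 0) (j : Fin 3) :
    aeval y (pderiv j F) = PowerSeries.C (PowerSeries.constantCoeff (aeval y (pderiv j F)) /
      PowerSeries.constantCoeff (aeval y (pderiv i F))) * aeval y (pderiv i F) := by
  set D := PowerSeries.derivative k
  set n : Fin 3 → PowerSeries k := fun j => aeval y (pderiv j F) with hn
  have hn0 : n i ≠ 0 := fun h0 => hi (by rw [show aeval y (pderiv i F) = n i from rfl, h0, map_zero])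
  have E := derivation_aeval D y F
  rw [hy, map_zero, Fin.sum_univ_three] at E
  have Dn : ∀ j, D (n j) = ∑ l, aeval y (pderiv j (pderiv l F)) * D (y l) := fun j => by
    rw [hn, derivation_aeval]
    exact Finset.sum_congr rfl fun l _ => by rw [pderiv_comm]
  have T : ∀ l, n i ^ 2 * aeval y (pderiv j (pderiv l F))
      - n i * n l * aeval y (pderiv j (pderiv i F)) - n j * n i * aeval y (pderiv i (pderiv l F))
      + n j * n l * aeval y (pderiv i (pderiv i F)) = 0 := by
    intro l
    obtain ⟨c, hc⟩ := hA (Pi.single j 1) (Pi.single l 1)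
    rw [hessian_tangent_single] at hc
    have := congrArg (aeval y) hc
    rw [map_mul, hy, zero_mul] at this
    simpa [n] using this
  -- This Wronskian identity is the combination of the `T l` with weights `D (y l)`, in which the
  -- surplus terms cancel by `E`, the derivative of `F = 0` along the arc. It makes `n j / n i` a
  -- series with derivative zero, constant in characteristic zero.
  have W : n i * D (n j) = n j * D (n i) := by
    refine mul_left_cancel₀ hn0 ?_
    rw [Dn, Dn, Fin.sum_univ_three, Fin.sum_univ_three]
    simp only [n] at T ⊢
    linear_combination D (y 0) * T 0 + D (y 1) * T 1 + D (y 2) * T 2 -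
      (aeval y (pderiv i F) * aeval y (pderiv j (pderiv i F)) -
        aeval y (pderiv j F) * aeval y (pderiv i (pderiv i F))) * E
  have hinv : n i * (n i)⁻¹ = 1 := PowerSeries.mul_inv_cancel _ hi
  have hconst : n j * (n i)⁻¹ = PowerSeries.C (PowerSeries.constantCoeff (n j) /
      PowerSeries.constantCoeff (n i)) := by
    refine PowerSeries.derivative.ext ?_ ?_
    · rw [PowerSeries.derivative_C]
      change D _ = 0
      rw [Derivation.leibniz, smul_eq_mul, smul_eq_mul,
        show D (n i)⁻¹ = -(n i)⁻¹ ^ 2 * D (n i) from PowerSeries.derivative_inv' _]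
      linear_combination (n i)⁻¹ ^ 2 * W - (n i)⁻¹ * D (n j) * hinv
    · simp [div_eq_mul_inv]
  change n j = _ * n i
  rw [← hconst]
  linear_combination - n j * hinv

/-- A surface whose second fundamental form vanishes identically is a plane. -/
theorem exists_dvd_linear [IsAlgClosed k] [CharZero k] {P : PlaneMap k}
    {F : MvPolynomial (Fin 3) k} (hF : Irreducible F) (hP : P.Parametrizes {x | eval x F = 0})
    {i : Fin 3} (hi : ¬ F ∣ pderiv i F)
    (hA : ∀ a, F ∣ hessian F (tangent F i a) (tangent F i a)) :
    ∃ (c : Fin 3 → k) (d : k), c i = 1 ∧ F ∣ ∑ j, C (c j) * X j - C d := by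
  -- Polarization, with `2` invertible.
  have hA' : ∀ a b, F ∣ hessian F (tangent F i a) (tangent F i b) := by
    intro a b
    have h := hA (a + b)
    rw [tangent_add, hessian_add_add, (dvd_add_left (hA b)), (dvd_add_right (hA a))] at h
    have h2 := h.mul_left (C (2⁻¹ : k))
    rwa [← mul_assoc, show (2 : MvPolynomial (Fin 3) k) = C 2 from (map_ofNat C 2).symm, ← C_mul,
      inv_mul_cancel₀ two_ne_zero, C_1, one_mul] at h2
  obtain ⟨p, hp, -, hpi⟩ := PlaneMap.exists_eval_ne_zero hF hP hi (h := 1) one_ne_zero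
  set x := P.evalAt (p 0) (p 1) with hx
  let c : Fin 3 → k := fun j => eval x (pderiv j F) / eval x (pderiv i F)
  refine ⟨c, ∑ j, c j * x j, div_self hpi, ?_⟩
  rw [PlaneMap.dvd_iff_of_parametrizes hF hP]
  refine PlaneMap.generic_eq_zero_of_dense (h := 1) one_ne_zero fun a b hd _ => ?_
  -- The segment from `p` to `(a, b)` in the parameter plane, expanded at `p`, is a formal arc `y`
  -- on the surface through `x`. Its normal direction stays equal to `c`, so `c · y` has derivative
  -- zero.
  let ι : Polynomial k →ₐ[k] PowerSeries k := Polynomial.coeToPowerSeries.algHom k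
  let φ := ι.comp (path p ![a, b])
  have hι : ∀ f, PowerSeries.constantCoeff (ι f) = f.eval 0 := by
    intro f
    simp [ι, Polynomial.coeToPowerSeries.algHom_apply, Polynomial.coeff_zero_eq_eval_zero]
  have hφ : ∀ g, PowerSeries.constantCoeff (φ g) = eval p g := by
    intro g
    rw [show φ g = ι (path p ![a, b] g) from rfl, hι, eval_zero_path]
  have hφden : φ P.den ≠ 0 := fun h0 => hp (by rw [← hφ, h0, map_zero])
  let y : Fin 3 → PowerSeries k := fun j => φ (P.num j) * (φ P.den)⁻¹
  have hyd : ∀ j, y j * φ P.den = φ (P.num j) := by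
    intro j
    rw [mul_assoc, PowerSeries.inv_mul_cancel _ (by rwa [hφ]), mul_one]
  have hyx : ∀ j, PowerSeries.constantCoeff (y j) = x j := by
    intro j
    simp only [y, map_mul, PowerSeries.constantCoeff_inv, hφ, hx, PlaneMap.evalAt, aeval_vec,
      div_eq_mul_inv]
  have hφv : ∀ g, aeval ![φ (X 0), φ (X 1)] g = φ g := by
    intro g
    have : (aeval ![φ (X 0), φ (X 1)] : MvPolynomial (Fin 2) k →ₐ[k] _) = φ := by
      ext1 l
      fin_cases l <;> simp
    rw [this]
  have hyF : aeval y F = 0 :=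
    PlaneMap.aeval_eq_zero_of_generic ((PlaneMap.dvd_iff_of_parametrizes hF hP).1 dvd_rfl)
      (a := φ (X 0)) (b := φ (X 1)) (by intro l; rw [hφv, hφv, hyd]) (by rwa [hφv])
  have hcy : ∀ G, PowerSeries.constantCoeff (aeval y G) = eval x G := by
    intro G
    rw [constantCoeff_aeval]
    simp only [hyx]
  have hN := normal_constant hA' hyF (by rwa [hcy])
  simp only [hcy] at hN
  have hni : aeval y (pderiv i F) ≠ 0 := fun h0 => hpi (by rw [← hcy, h0, map_zero])
  have E := derivation_aeval (PowerSeries.derivative k) y F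
  rw [hyF, map_zero] at E
  have hD : ∑ j, PowerSeries.C (c j) * PowerSeries.derivative k (y j) = 0 := by
    refine mul_left_cancel₀ hni ?_
    rw [mul_zero, E, Finset.mul_sum]
    refine Finset.sum_congr rfl fun j _ => ?_
    rw [hN j]
    ring
  have hconst : ∑ j, PowerSeries.C (c j) * y j = PowerSeries.C (∑ j, c j * x j) := by
    refine PowerSeries.derivative.ext ?_ ?_
    · rw [PowerSeries.derivative_C, map_sum, ← hD]
      refine Finset.sum_congr rfl fun j _ => ?_
      rw [Derivation.leibniz, PowerSeries.derivative_C, smul_zero, add_zero, smul_eq_mul]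
    · simp [hyx]
  -- After clearing the denominator, the identity of series is one of polynomials in the path
  -- parameter, so it can be evaluated at `1`, the point `(a, b)`.
  have hpoly : ι (∑ j, Polynomial.C (c j) * path p ![a, b] (P.num j)) =
      ι (Polynomial.C (∑ j, c j * x j) * path p ![a, b] P.den) := by
    have hιC : ∀ e, ι (Polynomial.C e) = PowerSeries.C e := by
      intro e
      simp [ι, Polynomial.coeToPowerSeries.algHom_apply]
    rw [map_sum, map_mul, hιC, ← hconst, Finset.sum_mul]
    refine Finset.sum_congr rfl fun j _ => ?_
    rw [map_mul, hιC, mul_assoc]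
    congr 1
    exact (hyd j).symm
  have hιinj : Function.Injective ι := fun f g h =>
    Polynomial.coe_injective k (by simpa [ι, Polynomial.coeToPowerSeries.algHom_apply] using h)
  have h1 := congrArg (Polynomial.eval 1) (hιinj hpoly)
  simp only [Polynomial.eval_finsetSum, Polynomial.eval_mul, Polynomial.eval_C, eval_one_path] at h1
  rw [MvPolynomial.aeval_eq_eval] at hd
  simp only [map_sub, map_sum, map_mul, aeval_C, aeval_X, PlaneMap.evalAt, MvPolynomial.aeval_eq_eval]
  rw [sub_eq_zero]
  rw [← mul_left_inj' hd, Finset.sum_mul]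
  simp only [mul_assoc]
  change ∑ j, c j * (eval ![a, b] (P.num j) / eval ![a, b] P.den * eval ![a, b] P.den) = _
  simp only [div_mul_cancel₀ _ (show eval ![a, b] P.den ≠ 0 from hd)]
  exact h1

/-- A plane has a parametrization in ruled form. -/
theorem exists_ruledForm_of_dvd_linear [IsAlgClosed k] {F : MvPolynomial (Fin 3) k}
    (hF : Irreducible F) {i : Fin 3} {c : Fin 3 → k} {d : k} (hc : c i = 1)
    (h : F ∣ ∑ j, C (c j) * X j - C d) :
    ∃ Q : RuledForm k, Q.toPlaneMap.Parametrizes {x | eval x F = 0} := by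
  have hF0 : ∀ x : Fin 3 → k, ∑ j, c j * x j = d → eval x F = 0 := by
    obtain ⟨g, hg⟩ := h
    have hne : ∑ j, C (c j) * X j - C d ≠ 0 := by
      intro h0
      have h1 := congrArg (eval fun l => if l = i then d + 1 else 0) h0
      simp [hc] at h1
    have hdeg : (∑ j, C (c j) * X j - C d).totalDegree ≤ 1 := by
      refine (totalDegree_sub _ _).trans (max_le ?_ (by simp))
      refine totalDegree_finsetSum_le fun j _ => ?_
      refine (totalDegree_mul _ _).trans ?_
      simp
    have hg0 : g ≠ 0 := by
      rintro rfl
      exact hne (by rw [hg, mul_zero])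
    rw [hg, totalDegree_mul_of_isDomain hF.ne_zero hg0] at hdeg
    have hFd : F.totalDegree ≠ 0 := by
      intro h0
      rw [totalDegree_eq_zero_iff_eq_C] at h0
      refine hF.not_isUnit ?_
      rw [h0]
      refine (IsUnit.mk0 _ fun h1 => hF.ne_zero ?_).map C
      rw [h0, h1, C_0]
    have hgC := totalDegree_eq_zero_iff_eq_C.1 (show g.totalDegree = 0 by omega)
    have hgc : g.coeff 0 ≠ 0 := fun h0 => hg0 (by rw [hgC, h0, C_0])
    intro x hx
    have := congrArg (eval x) hg
    rw [hgC] at this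
    simp [hx] at this
    exact this.resolve_right hgc
  obtain ⟨i₁, i₂, h1, h2, h12⟩ := exists_ne_ne i
  -- Each `v m` is annihilated by the linear form `c`; `v i₁` and `v i₂` span the directions of the
  -- plane.
  let v : Fin 3 → Fin 3 → k := fun m => Pi.single m 1 - c m • Pi.single i 1
  have hv : ∀ m, ∑ j, c j * v m j = 0 := by
    intro m
    simp [v, mul_sub, Finset.sum_sub_distrib, Pi.single_apply, hc]
  let Q : RuledForm k := ⟨fun j => Polynomial.C (d * (Pi.single i 1 : Fin 3 → k) j) +
    Polynomial.X * Polynomial.C (v i₁ j), fun j => Polynomial.C (v i₂ j), 1, one_ne_zero⟩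
  have hpt : ∀ a t : k, Q.point a t = d • Pi.single i 1 + a • v i₁ + t • v i₂ := by
    intro a t
    ext j
    simp [Q, RuledForm.point, mul_comm a]
  refine ⟨Q, Q.parametrizes_of_ne hF (fun a t _ => hF0 _ ?_) (a := 0) (b := 1) (t := 0) (i := i₂)
    (by simp [Q]) (by simp [Q]) (by simp [Q, v, h2]) fun u hu => ?_⟩
  · rw [hpt]
    simp only [Pi.add_apply, Pi.smul_apply, smul_eq_mul, mul_add, Finset.sum_add_distrib,
      mul_left_comm (c _), ← Finset.mul_sum, hv]
    simp [Pi.single_apply, hc]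
  · rw [hpt, hpt] at hu
    have := congrFun hu i₁
    simp [v, h1, h12] at this

end Plane

end RuledSurface

/-! ### Ruled forms from a rational field of lines. -/

namespace RuledSurface

open MvPolynomial

universe u

variable {k : Type u} [Field k]

/-- A surface is not contained in a line. -/
theorem PlaneMap.exists_notMem_line [IsAlgClosed k] {P : PlaneMap k} {F : MvPolynomial (Fin 3) k}
    (hF : Irreducible F) (hP : P.Parametrizes {x | eval x F = 0}) (x w : Fin 3 → k) :
    ∃ p : Fin 2 → k, eval p P.den ≠ 0 ∧ ∀ u : k, P.evalAt (p 0) (p 1) ≠ x + u • w := by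
  by_contra! H
  refine not_irreducible_of_dvd (fun l => ?_) hF
  obtain ⟨i, j, hi, hj, hij⟩ := exists_ne_ne l
  -- If the surface lay in a line, an equation of the projected line in the coordinates `i`, `j`
  -- would be a multiple of `F` free of the variable `l`.
  have key : ∀ G : MvPolynomial (Fin 2) k, (∀ u : k, eval ![x i + u * w i, x j + u * w j] G = 0) →
      F ∣ rename ![i, j] G := by
    intro G hG
    rw [dvd_iff_of_parametrizes hF hP]
    refine generic_eq_zero_of_dense (h := 1) one_ne_zero fun a b hd _ => ?_
    obtain ⟨u, hu⟩ := H ![a, b] (by rwa [MvPolynomial.aeval_eq_eval] at hd)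
    change P.evalAt a b = _ at hu
    rw [hu, aeval_rename, MvPolynomial.aeval_eq_eval, ← hG u]
    change eval _ G = eval _ G
    congr 2
    ext m
    fin_cases m <;> simp
  obtain ⟨G, hG0, hG⟩ : ∃ G : MvPolynomial (Fin 2) k, G ≠ 0 ∧
      ∀ u : k, eval ![x i + u * w i, x j + u * w j] G = 0 := by
    by_cases hw : w i = 0
    · refine ⟨X 0 - C (x i), fun h0 => ?_, fun u => by simp [hw]⟩
      have := congrArg (eval fun _ => x i + 1) h0
      simp at this
    · refine ⟨C (w j) * (X 0 - C (x i)) - C (w i) * (X 1 - C (x j)), fun h0 => hw ?_, fun u => ?_⟩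
      · have := congrArg (eval ![x i, x j + 1]) h0
        simpa using this
      · simp
        ring
  exact ⟨rename ![i, j] G, fun h0 => hG0 (rename_injective _ (injective_vec hij)
    (by rw [h0, map_zero])), key G hG, notMem_vars_rename hi hj G⟩

/-- A rational choice of a line through the generic point of a surface yields a parametrization of
the surface in ruled form. -/
theorem exists_ruledForm_of_direction [IsAlgClosed k] {P : PlaneMap k}
    {F : MvPolynomial (Fin 3) k} (hF : Irreducible F) (hP : P.Parametrizes {x | eval x F = 0})
    {v : Fin 3 → FunField k} (hv : v ≠ 0)
    (h : ∀ u : k, aeval (P.evalAt (FunField.s k) (FunField.t k) + u • v) F = 0) :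
    ∃ Q : RuledForm k, Q.toPlaneMap.Parametrizes {x | eval x F = 0} := by
  set ξ := P.evalAt (FunField.s k) (FunField.t k) with hξ
  -- A polynomial in `u` over `k(s,t)` that vanishes on the infinite field `k` is zero. Allowing `u
  -- ∈ k(s,t)` permits clearing the denominators of `v`.
  have hK : ∀ u : FunField k, aeval (ξ + u • v) F = 0 := by
    let φ : Polynomial (FunField k) := aeval
      (fun i => Polynomial.C (ξ i) + Polynomial.X * Polynomial.C (v i)) F
    have hφ : ∀ u, φ.eval u = aeval (ξ + u • v) F := by
      intro u
      have := MvPolynomial.comp_aeval_apply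
        (fun i => Polynomial.C (ξ i) + Polynomial.X * Polynomial.C (v i))
        ((Polynomial.aeval u : Polynomial (FunField k) →ₐ[FunField k] FunField k).restrictScalars k) F
      simp only [AlgHom.restrictScalars_apply, map_add, map_mul, Polynomial.aeval_C,
        Polynomial.aeval_X, Polynomial.coe_aeval_eq_eval] at this
      exact this
    have hφ0 : φ = 0 := by
      refine Polynomial.eq_zero_of_infinite_isRoot φ ?_
      refine (Set.infinite_range_of_injective
        (FaithfulSMul.algebraMap_injective k (FunField k))).mono ?_
      rintro _ ⟨u, rfl⟩
      have := h u
      rw [← algebraMap_smul (FunField k) u v, ← hφ] at this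
      exact this
    intro u
    rw [← hφ, hφ0, Polynomial.eval_zero]
  obtain ⟨b, hb⟩ := IsLocalization.exist_integer_multiples_of_finite
    (nonZeroDivisors (MvPolynomial (Fin 2) k)) v
  choose V hV using hb
  have hV' : ∀ i, algebraMap _ (FunField k) (V i) =
      algebraMap _ (FunField k) (b : MvPolynomial (Fin 2) k) * v i := by
    intro i
    rw [hV i, Algebra.smul_def]
  have hline : ∀ p : Fin 2 → k, eval p P.den ≠ 0 → ∀ u : k,
      eval (P.evalAt (p 0) (p 1) + u • fun i => eval p (V i)) F = 0 := by
    intro p hp u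
    let Pu : PlaneMap k := ⟨fun i => P.num i + C u * P.den * V i, P.den, P.den_ne_zero⟩
    have hgen : aeval (Pu.evalAt (FunField.s k) (FunField.t k)) F = 0 := by
      rw [← hK (algebraMap k _ u * algebraMap _ (FunField k) (b : MvPolynomial (Fin 2) k))]
      congr 2
      ext i
      have hd := PlaneMap.aeval_generic_ne_zero P.den_ne_zero
      simp only [Pu, PlaneMap.evalAt, Pi.add_apply, Pi.smul_apply, smul_eq_mul, hξ, map_add,
        map_mul, algHom_C]
      rw [mul_assoc _ _ (v i), ← hV', PlaneMap.aeval_generic (V i)]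
      field_simp
    have hden : aeval ![p 0, p 1] Pu.den ≠ 0 := by rwa [aeval_vec]
    have := PlaneMap.aeval_eq_zero_of_generic hgen (Pu.evalAt_mul_den hden) hden
    rw [MvPolynomial.aeval_eq_eval] at this
    rw [← this]
    change eval _ F = eval _ F
    congr 2
    ext i
    simp only [Pu, PlaneMap.evalAt, Pi.add_apply, Pi.smul_apply, smul_eq_mul, map_add,
        map_mul, aeval_vec, eval_C]
    field_simp
  obtain ⟨i, hi⟩ := Function.ne_iff.1 hv
  have hVi : V i ≠ 0 := by
    intro h0
    have := hV' i
    rw [h0, map_zero, eq_comm, mul_eq_zero] at this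
    rcases this with h1 | h1
    · exact nonZeroDivisors.coe_ne_zero b ((map_eq_zero_iff _ (IsFractionRing.injective _ _)).1 h1)
    · exact hi h1
  obtain ⟨p, hp, hpV, -⟩ := PlaneMap.exists_eval_ne_zero hF hP
    (G := 1) (fun h1 => hF.not_isUnit (isUnit_of_dvd_one h1)) hVi
  -- `P(p')` is off the line attached to `p`, so the lines attached to the points of the path from
  -- `p` to `p'` are not all the same.
  obtain ⟨p', hp', hne⟩ := PlaneMap.exists_notMem_line hF hP (P.evalAt (p 0) (p 1))
    fun i => eval p (V i)
  let Q : RuledForm k := ⟨fun i => path p p' (P.num i), fun i => path p p' (V i), path p p' P.den,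
    fun h0 => hp (by rw [← eval_zero_path p p', h0, Polynomial.eval_zero])⟩
  have hpt : ∀ w t : k, Q.q.eval w ≠ 0 → Q.point w t =
      P.evalAt (p 0 + (p' 0 - p 0) * w) (p 1 + (p' 1 - p 1) * w) +
        (t / Q.q.eval w) • fun i => eval (fun i => p i + (p' i - p i) * w) (V i) := by
    intro w t hw
    ext i
    have hvec := aeval_vec fun i => p i + (p' i - p i) * w
    simp only [Q, RuledForm.point, PlaneMap.evalAt, Pi.add_apply, Pi.smul_apply, smul_eq_mul,
      Polynomial.coe_aeval_eq_eval, eval_path, hvec]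
    ring
  refine ⟨Q, Q.parametrizes_of_ne hF (fun w t hw => ?_) (a := 0) (b := 1) (t := 0) (i := i)
    (by simpa [Q, eval_zero_path]) (by simpa [Q, eval_one_path]) (by simpa [Q, eval_zero_path])
    fun u hu => ?_⟩
  · rw [hpt w t hw]
    exact hline (fun i => p i + (p' i - p i) * w) (by rwa [← eval_path]) _
  · rw [hpt _ _ (by simpa [Q, eval_zero_path]), hpt _ _ (by simpa [Q, eval_one_path])] at hu
    simp only [mul_zero, add_zero, mul_one, add_sub_cancel, zero_div, zero_smul] at hu
    exact hne _ hu.symm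

end RuledSurface

namespace RuledSurface

open MvPolynomial

universe u

variable {k : Type u} [Field k]

/-! ### Asymptotic directions and the lines of a ruled surface. -/

section Asymptotic

variable (F : MvPolynomial (Fin 3) k) (i : Fin 3) (a b : Fin 3 → k)

/-- The discriminant of the second fundamental form, with respect to the tangent fields given by
`a` and `b`. -/
noncomputable def discr : MvPolynomial (Fin 3) k :=
  hessian F (tangent F i a) (tangent F i b) ^ 2 -
    hessian F (tangent F i a) (tangent F i a) * hessian F (tangent F i b) (tangent F i b)

/-- The asymptotic direction at `x` that corresponds to the square root `e` of the
discriminant. -/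
noncomputable def direction {L : Type*} [CommRing L] [Algebra k L] (x : Fin 3 → L) (e : L) :
    Fin 3 → L :=
  fun j => (e - aeval x (hessian F (tangent F i a) (tangent F i b))) * aeval x (tangent F i a j) +
    aeval x (hessian F (tangent F i a) (tangent F i a)) * aeval x (tangent F i b j)

theorem map_direction {L L' : Type*} [CommRing L] [Algebra k L] [CommRing L'] [Algebra k L']
    (φ : L →ₐ[k] L') (x : Fin 3 → L) (e : L) (j : Fin 3) :
    φ (direction F i a b x e j) = direction F i a b (fun l => φ (x l)) (φ e) j := by
  simp only [direction, map_add, map_mul, map_sub, MvPolynomial.comp_aeval_apply]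

theorem map_aeval_direction {L L' : Type*} [CommRing L] [Algebra k L] [CommRing L'] [Algebra k L']
    (φ : L →ₐ[k] L') (x : Fin 3 → L) (e : L) (u : k) :
    φ (aeval (x + u • direction F i a b x e) F) =
      aeval ((fun l => φ (x l)) + u • direction F i a b (fun l => φ (x l)) (φ e)) F := by
  rw [MvPolynomial.comp_aeval_apply]
  congr 2
  ext l
  simp [map_direction]

variable {F i a b}

theorem aeval_tangent {L : Type*} [CommRing L] [Algebra k L] (x : Fin 3 → L) (j : Fin 3) :
    aeval x (tangent F i a j) = aeval x (pderiv i F) * algebraMap k L (a j) -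
      (∑ l, algebraMap k L (a l) * aeval x (pderiv l F)) * if j = i then 1 else 0 := by
  simp only [tangent, map_sub, map_mul, map_sum, algHom_C]
  split_ifs <;> simp

/-- At coordinates other than `i` the two fields are `∂ᵢF · a` and `∂ᵢF · b`, so a nonzero minor of
`a`, `b` suffices. -/
theorem tangent_linearIndependent {L : Type*} [Field L] [Algebra k L] {i₁ i₂ : Fin 3}
    (h₁ : i₁ ≠ i) (h₂ : i₂ ≠ i) (hab : a i₁ * b i₂ - a i₂ * b i₁ ≠ 0) {x : Fin 3 → L}
    (hx : aeval x (pderiv i F) ≠ 0) {α β : L}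
    (h : ∀ j, α * aeval x (tangent F i a j) + β * aeval x (tangent F i b j) = 0) :
    α = 0 ∧ β = 0 := by
  have key : ∀ j, j ≠ i → α * algebraMap k L (a j) + β * algebraMap k L (b j) = 0 := by
    intro j hj
    have := h j
    rw [aeval_tangent, aeval_tangent, if_neg hj, mul_zero, mul_zero, sub_zero, sub_zero] at this
    refine (mul_eq_zero.1 (?_ : aeval x (pderiv i F) * _ = 0)).resolve_left hx
    linear_combination this
  have e1 := key i₁ h₁
  have e2 := key i₂ h₂
  have hδ : algebraMap k L (a i₁ * b i₂ - a i₂ * b i₁) ≠ 0 :=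
    (map_ne_zero_iff _ (FaithfulSMul.algebraMap_injective k L)).2 hab
  simp only [map_sub, map_mul] at hδ
  constructor
  · refine (mul_eq_zero.1 (?_ : _ * α = 0)).resolve_left hδ
    linear_combination algebraMap k L (b i₂) * e1 - algebraMap k L (b i₁) * e2
  · refine (mul_eq_zero.1 (?_ : _ * β = 0)).resolve_left hδ
    linear_combination algebraMap k L (a i₁) * e2 - algebraMap k L (a i₂) * e1

theorem direction_ne_zero {L : Type*} [Field L] [Algebra k L] {i₁ i₂ : Fin 3}
    (h₁ : i₁ ≠ i) (h₂ : i₂ ≠ i) (hab : a i₁ * b i₂ - a i₂ * b i₁ ≠ 0) {x : Fin 3 → L}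
    (hx : aeval x (pderiv i F) ≠ 0)
    (hA : aeval x (hessian F (tangent F i a) (tangent F i a)) ≠ 0) (e : L) :
    direction F i a b x e ≠ 0 := fun h0 =>
  hA (tangent_linearIndependent h₁ h₂ hab hx fun j => congrFun h0 j).2

theorem hessian_smul_smul (c d : k) (v w : Fin 3 → MvPolynomial (Fin 3) k) :
    hessian F ((C c : MvPolynomial (Fin 3) k) • v) ((C d : MvPolynomial (Fin 3) k) • w) =
      C c * C d * hessian F v w := by
  simp only [hessian, Finset.mul_sum, Pi.smul_apply, smul_eq_mul]
  exact Finset.sum_congr rfl fun _ _ => Finset.sum_congr rfl fun _ _ => by ring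

/-- The direction of a line in the surface, in terms of the two tangent fields, is a zero of the
second fundamental form. -/
theorem line_coordinates [Infinite k] {i₁ i₂ : Fin 3} (h₁ : i₁ ≠ i) (h₂ : i₂ ≠ i) (h₁₂ : i₁ ≠ i₂)
    {x v : Fin 3 → k} (h : ∀ u : k, eval (x + u • v) F = 0) {c d : k}
    (hv₁ : v i₁ = c * a i₁ + d * b i₁) (hv₂ : v i₂ = c * a i₂ + d * b i₂) :
    (∀ j, eval x (pderiv i F) * v j =
      c * eval x (tangent F i a j) + d * eval x (tangent F i b j)) ∧
    c ^ 2 * eval x (hessian F (tangent F i a) (tangent F i a)) +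
      2 * (c * d) * eval x (hessian F (tangent F i a) (tangent F i b)) +
      d ^ 2 * eval x (hessian F (tangent F i b) (tangent F i b)) = 0 := by
  obtain ⟨ht, hh⟩ := tangent_of_line h
  have hcover : ∀ j, j = i ∨ j = i₁ ∨ j = i₂ := by
    revert h₁ h₂ h₁₂
    clear hv₁ hv₂
    revert i i₁ i₂
    decide
  have hsum : ∀ f : Fin 3 → k, ∑ j, f j = f i + f i₁ + f i₂ := by
    intro f
    have : (Finset.univ : Finset (Fin 3)) = {i, i₁, i₂} := by
      ext j
      simpa using hcover j
    rw [this, Finset.sum_insert (by simp [h₁.symm, h₂.symm]), Finset.sum_insert (by simp [h₁₂]),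
      Finset.sum_singleton, add_assoc]
  have htan : ∀ a j, eval x (tangent F i a j) = eval x (pderiv i F) * a j -
      (∑ l, a l * eval x (pderiv l F)) * if j = i then 1 else 0 := by
    intro a j
    have := aeval_tangent (F := F) (i := i) (a := a) x j
    simpa [MvPolynomial.aeval_eq_eval] using this
  have hM : ∀ j, eval x (pderiv i F) * v j =
      c * eval x (tangent F i a j) + d * eval x (tangent F i b j) := by
    intro j
    rw [htan, htan]
    rcases hcover j with rfl | rfl | rfl
    · rw [hsum, hv₁, hv₂] at ht
      rw [hsum, hsum, if_pos rfl]
      linear_combination ht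
    · rw [if_neg h₁, hv₁]
      ring
    · rw [if_neg h₂, hv₂]
      ring
  refine ⟨hM, ?_⟩
  let w : Fin 3 → MvPolynomial (Fin 3) k :=
    (C c : MvPolynomial (Fin 3) k) • tangent F i a + (C d : MvPolynomial (Fin 3) k) • tangent F i b
  have h1 : eval x (hessian F w w) = 0 := by
    have : ∀ j, eval x (w j) = eval x (pderiv i F) * v j := by
      intro j
      rw [hM]
      simp [w]
    rw [hessian, map_sum]
    simp only [map_sum, map_mul, this]
    calc _ = eval x (pderiv i F) ^ 2 * ∑ i, ∑ j, v i * v j * eval x (pderiv i (pderiv j F)) := by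
          simp only [Finset.mul_sum]
          exact Finset.sum_congr rfl fun _ _ => Finset.sum_congr rfl fun _ _ => by ring
      _ = 0 := by rw [hh, mul_zero]
  rw [hessian_add_add, hessian_smul_smul, hessian_smul_smul, hessian_smul_smul] at h1
  simp only [map_add, map_mul, eval_C, map_ofNat] at h1
  linear_combination h1

theorem exists_coordinates {i₁ i₂ : Fin 3} (hab : a i₁ * b i₂ - a i₂ * b i₁ ≠ 0) (v : Fin 3 → k) :
    ∃ c d : k, v i₁ = c * a i₁ + d * b i₁ ∧ v i₂ = c * a i₂ + d * b i₂ := by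
  refine ⟨(v i₁ * b i₂ - v i₂ * b i₁) / (a i₁ * b i₂ - a i₂ * b i₁),
    (a i₁ * v i₂ - a i₂ * v i₁) / (a i₁ * b i₂ - a i₂ * b i₁), ?_, ?_⟩ <;>
  · rw [div_mul_eq_mul_div, div_mul_eq_mul_div, ← add_div, eq_div_iff hab]
    ring

/-- With `d = 0` the asymptotic equation becomes `c² A = 0` with `A ≠ 0`, so `v = 0`. Hence the
ratio `c / d` describes the direction of every line through `x`. -/
theorem coordinate_ne_zero [Infinite k] {i₁ i₂ : Fin 3} (h₁ : i₁ ≠ i) (h₂ : i₂ ≠ i)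
    (h₁₂ : i₁ ≠ i₂) {x v : Fin 3 → k} (hv : v ≠ 0) (h : ∀ u : k, eval (x + u • v) F = 0)
    (hx : eval x (pderiv i F) ≠ 0)
    (hA : eval x (hessian F (tangent F i a) (tangent F i a)) ≠ 0) {c d : k}
    (hv₁ : v i₁ = c * a i₁ + d * b i₁) (hv₂ : v i₂ = c * a i₂ + d * b i₂) : d ≠ 0 := by
  obtain ⟨hM, hq⟩ := line_coordinates h₁ h₂ h₁₂ h hv₁ hv₂
  rintro rfl
  have hc : c = 0 := by
    have : c ^ 2 * eval x (hessian F (tangent F i a) (tangent F i a)) = 0 := by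
      linear_combination hq
    exact pow_eq_zero_iff two_ne_zero |>.1 ((mul_eq_zero.1 this).resolve_right hA)
  refine hv (funext fun j => ?_)
  have := hM j
  rw [hc, zero_mul, zero_mul, add_zero] at this
  exact (mul_eq_zero.1 this).resolve_left hx

/-- At a general point of a ruled surface, one of the asymptotic directions is a line. -/
theorem exists_direction_of_ruled [Infinite k] {i₁ i₂ : Fin 3} (h₁ : i₁ ≠ i) (h₂ : i₂ ≠ i)
    (h₁₂ : i₁ ≠ i₂) (hab : a i₁ * b i₂ - a i₂ * b i₁ ≠ 0) {x v : Fin 3 → k} (hv : v ≠ 0)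
    (h : ∀ u : k, eval (x + u • v) F = 0) (hx : eval x (pderiv i F) ≠ 0)
    (hA : eval x (hessian F (tangent F i a) (tangent F i a)) ≠ 0) :
    ∃ e : k, e ^ 2 = eval x (discr F i a b) ∧
      ∀ u : k, eval (x + u • direction F i a b x e) F = 0 := by
  obtain ⟨c, d, hv₁, hv₂⟩ := exists_coordinates hab v
  have hd := coordinate_ne_zero h₁ h₂ h₁₂ hv h hx hA hv₁ hv₂
  obtain ⟨hM, hq⟩ := line_coordinates h₁ h₂ h₁₂ h hv₁ hv₂
  set A := eval x (hessian F (tangent F i a) (tangent F i a)) with hAdef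
  set B := eval x (hessian F (tangent F i a) (tangent F i b)) with hBdef
  -- `e` is chosen so that `(e - B : A) = (c : d)`, which makes the asymptotic direction
  -- proportional to `v`.
  refine ⟨(c * A + d * B) / d, ?_, fun u => ?_⟩
  · rw [discr, map_sub, map_pow, map_mul, ← hAdef, ← hBdef, div_pow, div_eq_iff (pow_ne_zero 2 hd)]
    linear_combination A * hq
  · have : direction F i a b x ((c * A + d * B) / d) = (A * eval x (pderiv i F) / d) • v := by
      ext j
      simp only [direction, MvPolynomial.aeval_eq_eval, Pi.smul_apply, smul_eq_mul]
      change (_ - B) * eval x _ + A * eval x _ = _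
      rw [div_mul_eq_mul_div, mul_assoc, hM]
      field_simp
      ring
    rw [this, smul_smul]
    exact h _

/-- The generic version of `exists_direction_of_ruled`. -/
theorem exists_direction_generic [IsAlgClosed k] (hruled : ∀ x, eval x F = 0 →
      ∃ v : Fin 3 → k, v ≠ 0 ∧ ∀ u : k, eval (x + u • v) F = 0)
    {i₁ i₂ : Fin 3} (h₁ : i₁ ≠ i) (h₂ : i₂ ≠ i) (h₁₂ : i₁ ≠ i₂)
    (hab : a i₁ * b i₂ - a i₂ * b i₁ ≠ 0) {L : Type*} [Field L] [Algebra k L] [IsAlgClosed L]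
    {x : Fin 3 → L} (hF : aeval x F = 0) (hx : aeval x (pderiv i F) ≠ 0)
    (hA : aeval x (hessian F (tangent F i a) (tangent F i a)) ≠ 0) :
    ∃ e : L, e ^ 2 = aeval x (discr F i a b) ∧
      ∀ u : k, aeval (x + u • direction F i a b x e) F = 0 := by
  obtain ⟨e, he⟩ := IsAlgClosed.exists_pow_nat_eq (aeval x (discr F i a b)) (n := 2) (by norm_num)
  -- Suppose both roots fail, at `u₁` and `u₂`. The `k`-algebra generated by `e` and the coordinates
  -- of `x` has a `k`-point that preserves both failures and the nondegeneracy; but there a line of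
  -- the surface has the asymptotic direction of one of the specialized roots.
  by_contra! H
  obtain ⟨u₁, hu₁⟩ := H e he
  obtain ⟨u₂, hu₂⟩ := H (-e) (by rw [neg_sq, he])
  classical
  let s : Finset L := insert e (Finset.univ.image x)
  let R := Algebra.adjoin k (s : Set L)
  have hfin : Algebra.FiniteType k R :=
    (Subalgebra.fg_iff_finiteType _).1 (Subalgebra.fg_adjoin_finset s)
  let y : Fin 3 → R := fun j => ⟨x j, Algebra.subset_adjoin (by simp [s])⟩
  let e' : R := ⟨e, Algebra.subset_adjoin (by simp [s])⟩
  have hval : ∀ G, R.val (aeval y G) = aeval x G := fun G =>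
    MvPolynomial.comp_aeval_apply y R.val G
  have hdir : ∀ ε u, R.val (aeval (y + u • direction F i a b y ε) F) =
      aeval (x + u • direction F i a b x (R.val ε)) F := fun ε u =>
    map_aeval_direction F i a b R.val y ε u
  let c : R := aeval (y + u₁ • direction F i a b y e') F *
    aeval (y + u₂ • direction F i a b y (-e')) F * aeval y (pderiv i F) *
    aeval y (hessian F (tangent F i a) (tangent F i a))
  have hc : c ≠ 0 := by
    intro h0
    have := congrArg R.val h0
    rw [map_zero, map_mul, map_mul, map_mul, hval, hval, hdir, hdir, map_neg] at this
    exact mul_ne_zero (mul_ne_zero (mul_ne_zero hu₁ hu₂) hx) hA this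
  obtain ⟨φ, hφ⟩ := exists_algHom_ne_zero (k := k) hc
  have hinj : Function.Injective R.val := Subtype.val_injective
  set z : Fin 3 → k := fun l => φ (y l) with hz
  have hφy : ∀ G, φ (aeval y G) = eval z G := fun G => by
    rw [MvPolynomial.comp_aeval_apply, MvPolynomial.aeval_eq_eval]
  simp only [c, map_mul, map_aeval_direction, hφy, map_neg] at hφ
  have hFz : eval z F = 0 := by
    rw [← hφy, show aeval y F = 0 from hinj (by rw [hval, hF, map_zero]), map_zero]
  have hez : φ e' ^ 2 = eval z (discr F i a b) := by
    rw [← hφy, ← map_pow]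
    congr 1
    exact hinj (by rw [hval, ← he, map_pow]; rfl)
  obtain ⟨v, hv, hline⟩ := hruled z hFz
  obtain ⟨⟨⟨hc1, hc2⟩, hc3⟩, hc4⟩ : ((_ ∧ _) ∧ _) ∧ _ := by
    simpa only [mul_ne_zero_iff] using hφ
  obtain ⟨ε, hε, hεl⟩ := exists_direction_of_ruled h₁ h₂ h₁₂ hab hv hline hc3 hc4
  rcases sq_eq_sq_iff_eq_or_eq_neg.1 (hε.trans hez.symm) with rfl | rfl
  · exact hc1 (by simpa [MvPolynomial.aeval_eq_eval] using hεl u₁)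
  · exact hc2 (by simpa [MvPolynomial.aeval_eq_eval] using hεl u₂)

end Asymptotic

end RuledSurface

/-! ### The irrational case and the existence of a ruled form. -/

namespace RuledSurface

open MvPolynomial

universe u

variable {k : Type u} [Field k]

/-- If the square root of the discriminant at the generic point of a surface is irrational, and one
asymptotic direction is a line, then both asymptotic directions at every point are lines. -/
theorem forall_direction_of_irrational [IsAlgClosed k] {P : PlaneMap k}
    {F : MvPolynomial (Fin 3) k} (hF : Irreducible F) (hP : P.Parametrizes {x | eval x F = 0})
    {i : Fin 3} {a b : Fin 3 → k} {L : Type u} [Field L] [Algebra k L] [Algebra (FunField k) L]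
    [IsScalarTower k (FunField k) L] {e : L} (he : e ∉ Set.range (algebraMap (FunField k) L))
    {x : Fin 3 → L}
    (hx : ∀ j, x j = algebraMap (FunField k) L (P.evalAt (FunField.s k) (FunField.t k) j))
    (hsq : e ^ 2 = aeval x (discr F i a b))
    (h : ∀ u : k, aeval (x + u • direction F i a b x e) F = 0) {z : Fin 3 → k} (hz : eval z F = 0)
    {ε : k} (hε : ε ^ 2 = eval z (discr F i a b)) (u : k) :
    eval (z + u • direction F i a b z ε) F = 0 := by
  let R := MvPolynomial (Fin 3) k
  let y : Fin 3 → Polynomial R := fun j => Polynomial.C (X j)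
  -- Conjugation by division: modulo `X² - discr` the line condition is `B X + A`. As `e` is not in
  -- `k(s,t)`, `B e + A = 0` forces `B` and `A` to vanish on the surface, so the condition holds for
  -- every square root at every point.
  let Ψ : Polynomial R := aeval (y + u • direction F i a b y Polynomial.X) F
  let m : Polynomial R := Polynomial.X ^ 2 - Polynomial.C (discr F i a b)
  have hm : m.Monic := Polynomial.monic_X_pow_sub_C _ two_ne_zero
  have hmd : m.natDegree = 2 := Polynomial.natDegree_X_pow_sub_C
  have hm1 : m ≠ 1 := by
    intro h1
    rw [h1, Polynomial.natDegree_one] at hmd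
    omega
  have hdeg : (Ψ %ₘ m).natDegree ≤ 1 := by
    have := Polynomial.natDegree_modByMonic_lt Ψ hm hm1
    omega
  obtain ⟨B, A, hBA⟩ : ∃ B A : R, Ψ %ₘ m = Polynomial.C B * Polynomial.X + Polynomial.C A :=
    ⟨_, _, Polynomial.eq_X_add_C_of_natDegree_le_one hdeg⟩
  have hdiv : Ψ = Polynomial.C B * Polynomial.X + Polynomial.C A + m * (Ψ /ₘ m) := by
    rw [← hBA, Polynomial.modByMonic_add_div]
  have hspec : ∀ {T : Type u} [CommRing T] [Algebra k T] (w : Fin 3 → T) (η : T),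
      η ^ 2 = aeval w (discr F i a b) →
      aeval (w + u • direction F i a b w η) F = aeval w B * η + aeval w A := by
    intro T _ _ w η hη
    let φ : Polynomial R →ₐ[k] T := Polynomial.aevalTower (aeval w) η
    have hφC : ∀ G, φ (Polynomial.C G) = aeval w G := fun G => Polynomial.aevalTower_C _ _ _
    have hφX : φ Polynomial.X = η := Polynomial.aevalTower_X _ _
    have h1 : φ Ψ = aeval (w + u • direction F i a b w η) F := by
      rw [map_aeval_direction, hφX]
      simp only [y, hφC, aeval_X]
    rw [← h1, hdiv]
    simp only [map_add, map_mul, hφC, hφX, m, map_sub, map_pow, hη, sub_self, zero_mul, add_zero]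
  set ξ := P.evalAt (FunField.s k) (FunField.t k)
  have hxG : ∀ G : R, aeval x G = algebraMap (FunField k) L (aeval ξ G) := by
    intro G
    have := MvPolynomial.comp_aeval_apply ξ (IsScalarTower.toAlgHom k (FunField k) L) G
    rw [IsScalarTower.coe_toAlgHom'] at this
    rw [this, show x = fun j => algebraMap (FunField k) L (ξ j) from funext hx]
  have hrel := hspec x e hsq
  rw [h u, hxG, hxG] at hrel
  have hB : aeval ξ B = 0 := by
    by_contra hB
    refine he ⟨- aeval ξ A / aeval ξ B, ?_⟩
    have hB' : algebraMap (FunField k) L (aeval ξ B) ≠ 0 :=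
      (map_ne_zero_iff _ (algebraMap (FunField k) L).injective).2 hB
    rw [map_div₀, map_neg, div_eq_iff hB']
    linear_combination hrel
  have hA : aeval ξ A = 0 := by
    rw [hB, map_zero, zero_mul, zero_add, eq_comm, map_eq_zero] at hrel
    exact hrel
  obtain ⟨B', rfl⟩ := (PlaneMap.dvd_iff_of_parametrizes hF hP).2 hB
  obtain ⟨A', rfl⟩ := (PlaneMap.dvd_iff_of_parametrizes hF hP).2 hA
  have := hspec z ε (by rw [MvPolynomial.aeval_eq_eval]; exact hε)
  simp only [MvPolynomial.aeval_eq_eval, map_mul] at this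
  change eval _ F = eval z F * _ * _ + eval z F * _ at this
  rw [this, hz]
  ring

/-- A surface all of whose asymptotic directions are lines is parametrized by the second lines
through the points of one of its lines. -/
theorem exists_ruledForm_of_forall_direction [IsAlgClosed k] [CharZero k] {P : PlaneMap k}
    {F : MvPolynomial (Fin 3) k} (hF : Irreducible F) (hP : P.Parametrizes {x | eval x F = 0})
    (hruled : ∀ x, eval x F = 0 → ∃ v : Fin 3 → k, v ≠ 0 ∧ ∀ u : k, eval (x + u • v) F = 0)
    {i i₁ i₂ : Fin 3} {a b : Fin 3 → k} (h₁ : i₁ ≠ i) (h₂ : i₂ ≠ i) (h₁₂ : i₁ ≠ i₂)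
    (hab : a i₁ * b i₂ - a i₂ * b i₁ ≠ 0) (hi : ¬ F ∣ pderiv i F)
    (hA : ¬ F ∣ hessian F (tangent F i a) (tangent F i a)) (hD : ¬ F ∣ discr F i a b)
    (h : ∀ z, eval z F = 0 → ∀ ε, ε ^ 2 = eval z (discr F i a b) → ∀ u : k,
      eval (z + u • direction F i a b z ε) F = 0) :
    ∃ Q : RuledForm k, Q.toPlaneMap.Parametrizes {x | eval x F = 0} := by
  have hG : ¬ F ∣ pderiv i F * hessian F (tangent F i a) (tangent F i a) * discr F i a b := by
    intro hdvd
    rcases hF.prime.dvd_or_dvd hdvd with hdvd | hdvd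
    · rcases hF.prime.dvd_or_dvd hdvd with hdvd | hdvd
      exacts [hi hdvd, hA hdvd]
    · exact hD hdvd
  obtain ⟨p, hp, -, hpG⟩ := PlaneMap.exists_eval_ne_zero hF hP hG (h := 1) one_ne_zero
  have hF₀ := PlaneMap.eval_eq_zero hP hp
  set x := P.evalAt (p 0) (p 1)
  rw [map_mul, map_mul, mul_ne_zero_iff, mul_ne_zero_iff] at hpG
  obtain ⟨⟨hxi, hxA⟩, hxD⟩ := hpG
  obtain ⟨v, hv, hline⟩ := hruled x hF₀
  obtain ⟨c, d, hv₁, hv₂⟩ := exists_coordinates hab v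
  have hd := coordinate_ne_zero h₁ h₂ h₁₂ hv hline hxi hxA hv₁ hv₂
  let y : Fin 3 → Polynomial k := fun j => Polynomial.C (x j) + Polynomial.X * Polynomial.C (v j)
  -- The coordinates `c`, `d` of `v` are the same at all points of the line, so `E` is the square
  -- root of the discriminant that belongs to the line itself; `-E` belongs to the other asymptotic
  -- direction.
  let E : Polynomial k := Polynomial.C (c / d) * aeval y (hessian F (tangent F i a) (tangent F i a)) +
    aeval y (hessian F (tangent F i a) (tangent F i b))
  have hy : ∀ u, (fun j => Polynomial.eval u (y j)) = x + u • v := by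
    intro u
    ext j
    simp only [y, Polynomial.eval_add, Polynomial.eval_C, Polynomial.eval_mul, Polynomial.eval_X,
      Pi.add_apply, Pi.smul_apply, smul_eq_mul]
  have hyG : ∀ u G, Polynomial.eval u (aeval y G) = eval (x + u • v) G := by
    intro u G
    rw [eval_aeval_polynomial, hy]
  have hE : ∀ u, E.eval u = c / d *
      eval (x + u • v) (hessian F (tangent F i a) (tangent F i a)) +
      eval (x + u • v) (hessian F (tangent F i a) (tangent F i b)) := by
    intro u
    simp only [E, Polynomial.eval_add, Polynomial.eval_mul, Polynomial.eval_C, hyG]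
  have hE2 : ∀ u, E.eval u ^ 2 = eval (x + u • v) (discr F i a b) := by
    intro u
    obtain ⟨-, hq⟩ := line_coordinates h₁ h₂ h₁₂ (x := x + u • v)
      (fun w => by rw [add_assoc, ← add_smul]; exact hline _) hv₁ hv₂
    rw [hE, discr, map_sub, map_pow, map_mul]
    field_simp
    linear_combination eval (x + u • v) (hessian F (tangent F i a) (tangent F i a)) * hq
  let Q : RuledForm k := ⟨y, direction F i a b y (-E), 1, one_ne_zero⟩
  have hdir : ∀ u j, (direction F i a b y (-E) j).eval u =
      direction F i a b (x + u • v) (-E.eval u) j := by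
    intro u j
    have := map_direction F i a b (Polynomial.aeval u) y (-E) j
    simpa [hy] using this
  have hpt : ∀ u t : k, Q.point u t =
      (x + u • v) + t • direction F i a b (x + u • v) (-E.eval u) := by
    intro u t
    ext j
    have : Polynomial.eval u (y j) = x j + u * v j := congrFun (hy u) j
    simp [Q, RuledForm.point, hdir, this]
  have hne : direction F i a b x (-E.eval 0) ≠ 0 :=
    direction_ne_zero h₁ h₂ hab (by rwa [MvPolynomial.aeval_eq_eval])
      (by rwa [MvPolynomial.aeval_eq_eval]) _
  obtain ⟨j, hj⟩ := Function.ne_iff.1 hne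
  refine ⟨Q, Q.parametrizes_of_ne hF (fun u t _ => ?_) (a := 0) (b := 1) (t := 0) (i := j)
    (by simp [Q]) (by simp [Q]) (by simpa [Q, hdir] using hj) fun t ht => ?_⟩
  · rw [hpt]
    exact h _ (hline u) _ (by rw [neg_sq, hE2]) t
  · rw [hpt, hpt] at ht
    simp only [zero_smul, add_zero, one_smul, add_right_inj] at ht
    obtain ⟨hM, -⟩ := line_coordinates h₁ h₂ h₁₂ hline hv₁ hv₂
    have hE0 := hE 0
    have hE20 := hE2 0
    rw [zero_smul, add_zero] at hE0 hE20
    set A := eval x (hessian F (tangent F i a) (tangent F i a))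
    set B := eval x (hessian F (tangent F i a) (tangent F i b))
    set M := eval x (pderiv i F)
    -- If the second line at `x` contained `x + v`, it would have direction `v`; comparing tangent
    -- coordinates gives `-E(0) = E(0)`, against the nonzero discriminant at `x`.
    obtain ⟨e1, e2⟩ := tangent_linearIndependent (F := F) h₁ h₂ hab (x := x)
      (by rwa [MvPolynomial.aeval_eq_eval]) (α := c - M * t * (-E.eval 0 - B))
      (β := d - M * t * A) (by
        intro j
        have h1 := congrFun ht j
        simp only [Pi.smul_apply, smul_eq_mul, direction, MvPolynomial.aeval_eq_eval] at h1 ⊢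
        change t * ((_ - B) * eval x _ + A * eval x _) = v j at h1
        change _ * eval x _ + _ * eval x _ = 0
        linear_combination -M * h1 - hM j)
    have h0 : 2 * d * E.eval 0 = 0 := by
      have hE0' : d * E.eval 0 = c * A + d * B := by
        rw [hE0]
        field_simp
      linear_combination hE0' + A * e1 - (-E.eval 0 - B) * e2
    have hE00 : E.eval 0 = 0 :=
      (mul_eq_zero.1 h0).resolve_left (mul_ne_zero two_ne_zero hd)
    exact hxD (by rw [← hE20, hE00]; ring)

/-- Differentiation lowers the degree in its variable, so `F ∣ ∂ᵢF` forces `∂ᵢF = 0`; in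
characteristic zero this for all `i` makes `F` constant. -/
theorem exists_not_dvd_pderiv [CharZero k] {F : MvPolynomial (Fin 3) k} (hF : Irreducible F) :
    ∃ i, ¬ F ∣ pderiv i F := by
  by_contra! h
  have hz : ∀ i, pderiv i F = 0 := by
    intro i
    by_contra hne
    obtain ⟨g, hg⟩ := h i
    have hg0 : g ≠ 0 := by
      rintro rfl
      exact hne (by rw [hg, mul_zero])
    have hvar : F.degreeOf i ≠ 0 := by
      rw [← mem_vars_iff_degreeOf_ne_zero]
      by_contra hi
      exact hne (pderiv_eq_zero_of_notMem_vars hi)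
    have h1 : (pderiv i F).degreeOf i < F.degreeOf i := by
      rw [degreeOf_lt_iff (Nat.pos_of_ne_zero hvar)]
      intro m hm
      rw [mem_support_iff, coeff_pderiv] at hm
      have hm' := left_ne_zero_of_mul hm
      have := (degreeOf_lt_iff (n := i) (f := F) (d := F.degreeOf i + 1) (Nat.succ_pos _)).1
        (Nat.lt_succ_self _) _ (mem_support_iff.2 hm')
      simp at this
      omega
    rw [hg, degreeOf_mul_eq hF.ne_zero hg0] at h1
    omega
  have hC : F = C (F.coeff 0) := by
    ext m
    rw [coeff_C]
    split_ifs with hm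
    · rw [hm]
    · obtain ⟨i, hi⟩ := Finsupp.ne_iff.1 (Ne.symm hm)
      have hi' : m i ≠ 0 := hi
      have h1 := congrArg (coeff (m - Finsupp.single i 1)) (hz i)
      rw [coeff_pderiv, coeff_zero, tsub_add_cancel_of_le
        (Finsupp.single_le_iff.2 (Nat.one_le_iff_ne_zero.2 hi'))] at h1
      refine (mul_eq_zero.1 h1).resolve_right ?_
      exact Nat.cast_add_one_ne_zero _
  refine hF.not_isUnit ?_
  rw [hC]
  refine (IsUnit.mk0 _ fun h0 => hF.ne_zero ?_).map C
  rw [hC, h0, C_0]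

/-- Every rational ruled surface has a parametrization in ruled form. -/
theorem exists_ruledForm [IsAlgClosed k] [CharZero k] {P : PlaneMap k}
    {F : MvPolynomial (Fin 3) k} (hF : Irreducible F) (hP : P.Parametrizes {x | eval x F = 0})
    (hruled : ∀ x, eval x F = 0 → ∃ v : Fin 3 → k, v ≠ 0 ∧ ∀ u : k, eval (x + u • v) F = 0) :
    ∃ Q : RuledForm k, Q.toPlaneMap.Parametrizes {x | eval x F = 0} := by
  obtain ⟨i, hi⟩ := exists_not_dvd_pderiv hF
  by_cases hA : ∀ a, F ∣ hessian F (tangent F i a) (tangent F i a)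
  · obtain ⟨c, d, hc, hdvd⟩ := exists_dvd_linear hF hP hi hA
    exact exists_ruledForm_of_dvd_linear hF hc hdvd
  push Not at hA
  obtain ⟨a, hA⟩ := hA
  obtain ⟨i₁, i₂, b, h₁, h₂, h₁₂, hab⟩ : ∃ (i₁ i₂ : Fin 3) (b : Fin 3 → k), i₁ ≠ i ∧ i₂ ≠ i ∧
      i₁ ≠ i₂ ∧ a i₁ * b i₂ - a i₂ * b i₁ ≠ 0 := by
    -- The tangent field of the `i`-th unit vector is zero, so `a` has a nonzero coordinate other
    -- than the `i`-th; `b` is the unit vector of the remaining index.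
    obtain ⟨j, hji, haj⟩ : ∃ j, j ≠ i ∧ a j ≠ 0 := by
      by_contra! h0
      refine hA ?_
      have hzero : tangent F i a = 0 := by
        ext1 j
        rw [tangent, Finset.sum_eq_single i (fun l _ hl => by rw [h0 l hl, C_0, zero_mul])
          (by simp)]
        split_ifs with hj
        · rw [hj]
          simp [mul_comm]
        · simp [h0 j hj]
      simp [hzero, hessian]
    obtain ⟨l, hl⟩ : ∃ l : Fin 3, l ≠ i ∧ j ≠ l := by
      clear hi hA hji haj
      decide +revert
    exact ⟨j, l, Pi.single l 1, hji, hl.1, hl.2, by simpa [hl.2] using haj⟩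
  let L := AlgebraicClosure (FunField k)
  set ξ := P.evalAt (FunField.s k) (FunField.t k) with hξ
  let x : Fin 3 → L := fun j => algebraMap (FunField k) L (ξ j)
  have hxG : ∀ G, aeval x G = algebraMap (FunField k) L (aeval ξ G) := fun G =>
    (MvPolynomial.comp_aeval_apply ξ (IsScalarTower.toAlgHom k (FunField k) L) G).symm
  have hx0 : ∀ G, aeval x G = 0 ↔ F ∣ G := fun G => by
    rw [hxG, map_eq_zero, PlaneMap.dvd_iff_of_parametrizes hF hP]
  obtain ⟨e, he, hline⟩ := exists_direction_generic hruled h₁ h₂ h₁₂ hab (x := x)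
    ((hx0 F).2 dvd_rfl) (mt (hx0 _).1 hi) (mt (hx0 _).1 hA)
  by_cases hrat : e ∈ Set.range (algebraMap (FunField k) L)
  · obtain ⟨e', rfl⟩ := hrat
    refine exists_ruledForm_of_direction hF hP (v := direction F i a b ξ e')
      (direction_ne_zero h₁ h₂ hab ?_ ?_ e') fun u => ?_
    · rwa [Ne, ← PlaneMap.dvd_iff_of_parametrizes hF hP]
    · rwa [Ne, ← PlaneMap.dvd_iff_of_parametrizes hF hP]
    · have h1 := map_aeval_direction F i a b (IsScalarTower.toAlgHom k (FunField k) L) ξ e' u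
      have h2 := hline u
      refine (algebraMap (FunField k) L).injective ?_
      rw [map_zero]
      exact h1.trans h2
  · refine exists_ruledForm_of_forall_direction hF hP hruled h₁ h₂ h₁₂ hab hi hA ?_
      fun z hz ε hε u => forall_direction_of_irrational hF hP hrat (fun _ => rfl) he hline hz hε u
    -- A discriminant vanishing on the surface would give `e = 0`, which is rational.
    intro hdvd
    rw [(hx0 _).2 hdvd] at he
    refine hrat ⟨0, ?_⟩
    rw [map_zero, eq_comm]
    exact pow_eq_zero_iff two_ne_zero |>.1 he

end RuledSurface

theorem mainTheorem7 {k : Type*} [Field k] [IsAlgClosed k] [CharZero k]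
    (S : Set (Fin 3 → k)) (hS : RuledSurface.IsRationalRuledSurface S) :
    (∃ Q : RuledSurface.RuledForm k, Q.IsStandardized S) ∧
    ∀ P : RuledSurface.RuledForm k, P.toPlaneMap.Parametrizes S →
      ∃ Q : RuledSurface.RuledForm k, Q.IsStandardized S ∧
        RuledSurface.IsReparametrization Q.toPlaneMap P.toPlaneMap := by
  obtain ⟨⟨F, hF, rfl⟩, hruled, P₀, hP₀⟩ := hS
  have key : ∀ P : RuledSurface.RuledForm k,
      P.toPlaneMap.Parametrizes {x | MvPolynomial.eval x F = 0} →
      ∃ Q : RuledSurface.RuledForm k, Q.IsStandardized {x | MvPolynomial.eval x F = 0} ∧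
        RuledSurface.IsReparametrization Q.toPlaneMap P.toPlaneMap := fun P hP =>
    RuledSurface.RuledForm.exists_isStandardized hP
      (RuledSurface.RuledForm.exists_p_ne_zero hF hP)
  refine ⟨?_, key⟩
  obtain ⟨P, hP⟩ := RuledSurface.exists_ruledForm hF hP₀ hruled
  obtain ⟨Q, hQ, -⟩ := key P hP
  exact ⟨Q, hQ⟩
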